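/- Let $\Lambda$ be an artin algebra, let $\mathrm{mod}\text{-}\Lambda$ be the category of finitely generated right $\Lambda$-modules, and let $\mathcal X=\mathrm{add}(X)$ be a full subcategory of $\mathrm{mod}\text{-}\Lambda$ of finite type with additive generator $X\in\mathcal X$ (every module in $\mathcal X$ is a direct summand of some $X^n$, and conversely). Assume that $\mathcal X$ is contravariantly finite, contains all finitely generated projective modules, is closed under submodules, and is contained in ${}^{\perp}\Lambda=\{M : \mathrm{Ext}^i_\Lambda(M,\Lambda)=0\ \text{for all } i\ge 1\}$. Let $\mathrm{mod}\text{-}\mathcal X$ be the category of finitely presented additive contravariant functors from $\mathcal X$ to abelian groups, let $\vartheta:\mathrm{mod}\text{-}\mathcal X\to\mathrm{mod}\text{-}\Lambda$ be the functor sending $F$ with presentation $(-,X_1)\xrightarrow{(-,d)}(-,X_0)\to F\to 0$ (with $X_0,X_1\in\mathcal X$) to $\mathrm{Coker}(d)$, and let $\mathrm{mod}_0\text{-}\mathcal X$ be the full subcategory of the functors vanishing at $\Lambda$. Put $\Gamma=\mathbf{Aus}(\mathcal X)=\mathrm{End}_\Lambda(X)$, let $e:\mathrm{mod}\text{-}\mathcal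 X\to\mathrm{mod}\text{-}\Gamma$, $F\mapsto F(X)$, be the evaluation equivalence, and put $\mu=\vartheta e^{-1}$ and $\mathrm{mod}_0\text{-}\Gamma=\mathrm{Ker}\,\mu$. Then the inclusion $\mathrm{mod}_0\text{-}\mathcal X\to\mathrm{mod}\text{-}\mathcal X$ together with $\vartheta$ is the middle row of a recollement $\mathcal R(\mathcal X,\Lambda)$, and the inclusion $L:\mathrm{mod}_0\text{-}\Gamma\to\mathrm{mod}\text{-}\Gamma$ together with $\mu$ is the middle row of a recollement $\mathcal R(\mathcal X,\Gamma)$. Let $\vartheta_\lambda$ and $\vartheta_\rho$ be the left and right adjoints of $\vartheta$, let $\gamma_X:\vartheta_\lambda(X)\to\vartheta_\rho(X)$ be the morphism adjoint to the inverse of the counit $\vartheta\vartheta_\rho(X)\to X$, let $\zeta^{\mathcal X}_X=\mathrm{Im}(\gamma_X)$, and let $T=\zeta^{\mathcal X}_X(X)$ be its value at $X$, a right $\Gamma$-module. Let $L_\lambda$ and $L_\rho$ be the left and right adjoints of $L$. Let $\mathrm{gen}(T)$ (respectively $\mathrm{cogen}(T)$) be the class of all finitely generated right $\Gamma$-modules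 that are quotients (respectively submodules) of $T^n$ for some $n$, and let $\mathcal P^{\le 1}(\Gamma)$ (respectively $\mathcal I^{\le 1}(\Gamma)$) be the class of finitely generated right $\Gamma$-modules of projective (respectively injective) dimension at most $1$. Then: (i) $\mathrm{cogen}(T)\subseteq\mathrm{Ker}\,L_\rho=\mathcal P^{\le 1}(\Gamma)$; if $\Lambda$ is self-injective, then the inclusion is an equality. (ii) $\mathrm{Ker}\,L_\lambda=\mathrm{gen}(T)\subseteq\mathcal I^{\le 1}(\Gamma)$; if $\Lambda$ is self-injective, then the inclusion is an equality. -/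

import Mathlib

open CategoryTheory Opposite

universe u v₁ v₂ v₃ u₁ u₂ u₃

noncomputable section

namespace RelAus

/-- `Λ` is an artin algebra: module-finite over some commutative artinian ring. (The base ring may be
taken in the universe of `Λ`, since it can be replaced by its image in the centre of `Λ`.) -/
class IsArtinAlgebra (Λ : Type u) [Ring Λ] : Prop where
  exists_base : ∃ (k : Type u) (_ : CommRing k) (_ : IsArtinianRing k) (_ : Algebra k Λ),
    Module.Finite k Λ

/-- `mod-A`: finitely generated right `A`-modules. -/
abbrev RMod (A : Type u) [Ring A] := FGModuleCat.{u} Aᵐᵒᵖ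

instance finite_regular (A : Type u) [Ring A] : Module.Finite Aᵐᵒᵖ A :=
  ⟨⟨{1}, by
    rw [eq_top_iff]
    intro x _
    rw [Finset.coe_singleton, Submodule.mem_span_singleton]
    exact ⟨MulOpposite.op x, by simp⟩⟩⟩

/-- The right regular module. -/
abbrev regular (A : Type u) [Ring A] : RMod A := FGModuleCat.of Aᵐᵒᵖ A

section Subcategories

variable {Λ : Type u} [Ring Λ]

/-- `add(X)`: direct summands of finite direct sums of copies of `X`. -/
def addClosure (X : RMod Λ) : ObjectProperty (RMod Λ) := fun M =>
  ∃ (n : ℕ) (s : M →ₗ[Λᵐᵒᵖ] (Fin n → X)) (r : (Fin n → X) →ₗ[Λᵐᵒᵖ] M), r ∘ₗ s = LinearMap.id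

/-- `gen(T)`: quotients of finite direct sums of copies of `T`. -/
def gen (T : RMod Λ) : ObjectProperty (RMod Λ) := fun M =>
  ∃ (n : ℕ) (p : (Fin n → T) →ₗ[Λᵐᵒᵖ] M), Function.Surjective p

/-- `cogen(T)`: submodules of finite direct sums of copies of `T`. -/
def cogen (T : RMod Λ) : ObjectProperty (RMod Λ) := fun M =>
  ∃ (n : ℕ) (i : M →ₗ[Λᵐᵒᵖ] (Fin n → T)), Function.Injective i

/-- Finitely generated right modules of projective dimension at most `1`. -/
def projDimLEOne (Λ : Type u) [Ring Λ] : ObjectProperty (RMod Λ) := fun M =>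
  HasProjectiveDimensionLE M.obj 1

/-- Finitely generated right modules of injective dimension at most `1`. -/
def injDimLEOne (Λ : Type u) [Ring Λ] : ObjectProperty (RMod Λ) := fun M =>
  HasInjectiveDimensionLE M.obj 1

/-- Finitely generated projective right modules. -/
def prj (Λ : Type u) [Ring Λ] : ObjectProperty (RMod Λ) := fun M => Module.Projective Λᵐᵒᵖ M

lemma prj_regular (Λ : Type u) [Ring Λ] : prj Λ (regular Λ) := by
  let e : Λᵐᵒᵖ ≃ₗ[Λᵐᵒᵖ] Λ :=
    { toFun := MulOpposite.unop
      map_add' := fun _ _ => rfl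
      map_smul' := fun _ _ => rfl
      invFun := MulOpposite.op
      left_inv := fun _ => rfl
      right_inv := fun _ => rfl }
  exact Module.Projective.of_equiv e

/-- `Λ` is self-injective: injective as a right module over itself. -/
def IsSelfInjective (Λ : Type u) [Ring Λ] : Prop := Module.Injective Λᵐᵒᵖ Λ

/-- `⊥Λ`: the modules `M` with `Ext^i(M, Λ) = 0` for all `i ≥ 1`. -/
def leftPerp (Λ : Type u) [Ring Λ] : ObjectProperty (RMod Λ) := fun M =>
  ∀ i : ℕ, 1 ≤ i → Subsingleton (Abelian.Ext M.obj (regular Λ).obj i)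

/-- Every finitely generated module has a right `𝒳`-approximation. -/
def ContravariantlyFinite (𝒳 : ObjectProperty (RMod Λ)) : Prop :=
  ∀ M : RMod Λ, ∃ (Y : RMod Λ) (f : Y ⟶ M), 𝒳 Y ∧
    ∀ (Z : RMod Λ) (g : Z ⟶ M), 𝒳 Z → ∃ h : Z ⟶ Y, h ≫ f = g

end Subcategories

section Recollements

variable {A' : Type u₁} {A : Type u₂} {A'' : Type u₃} [Category.{v₁} A'] [Category.{v₂} A]
  [Category.{v₃} A''] [Preadditive A'] [Preadditive A] [Preadditive A'']

/-- A recollement with given middle row `A' --ℓ--> A --ϑ--> A''`. -/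
structure Recollement (ℓ : A' ⥤ A) (ϑ : A ⥤ A'') where
  ℓlam : A ⥤ A'
  ℓrho : A ⥤ A'
  ϑlam : A'' ⥤ A
  ϑrho : A'' ⥤ A
  additive_ℓ : ℓ.Additive
  additive_ϑ : ϑ.Additive
  additive_ℓlam : ℓlam.Additive
  additive_ℓrho : ℓrho.Additive
  additive_ϑlam : ϑlam.Additive
  additive_ϑrho : ϑrho.Additive
  adjℓlam : ℓlam ⊣ ℓ
  adjℓrho : ℓ ⊣ ℓrho
  adjϑlam : ϑlam ⊣ ϑ
  adjϑrho : ϑ ⊣ ϑrho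
  full_ℓ : ℓ.Full
  faithful_ℓ : ℓ.Faithful
  full_ϑlam : ϑlam.Full
  faithful_ϑlam : ϑlam.Faithful
  full_ϑrho : ϑrho.Full
  faithful_ϑrho : ϑrho.Faithful
  im_eq_ker : ℓ.essImage = ϑ.kernel

attribute [instance] Recollement.full_ϑrho Recollement.faithful_ϑrho

variable {ℓ : A' ⥤ A} {ϑ : A ⥤ A''}

/-- `γ_M : ϑ_λ(M) ⟶ ϑ_ρ(M)`, adjoint to the inverse of the counit `ϑϑ_ρ(M) ⟶ M`. -/
def Recollement.γ (R : Recollement ℓ ϑ) (M : A'') : R.ϑlam.obj M ⟶ R.ϑrho.obj M :=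
  (R.adjϑlam.homEquiv M (R.ϑrho.obj M)).symm (inv (R.adjϑrho.counit.app M))

/-- The intermediate extension `ζ(M) = Im(γ_M)`. -/
def Recollement.ζ [Limits.HasImages A] (R : Recollement ℓ ϑ) (M : A'') : A := Limits.image (R.γ M)

end Recollements

section FinitelyPresentedFunctors

variable {Λ : Type u} [Ring Λ] (𝒳 : ObjectProperty (RMod Λ))

/-- The functor `(-, M)|_𝒳`. -/
abbrev homX (M : RMod Λ) : 𝒳.FullSubcategoryᵒᵖ ⥤ AddCommGrpCat.{u} :=
  𝒳.ι.op ⋙ preadditiveYoneda.obj M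

variable {𝒳} in
/-- A presentation `(-, X₁) ⟶ (-, X₀) ⟶ F ⟶ 0` with `X₁, X₀` in `𝒳`; the first map is `(-, d)`. -/
structure Presentation (F : 𝒳.FullSubcategoryᵒᵖ ⥤ AddCommGrpCat.{u}) where
  X₁ : 𝒳.FullSubcategory
  X₀ : 𝒳.FullSubcategory
  d : X₁.obj ⟶ X₀.obj
  π : homX 𝒳 X₀.obj ⟶ F
  surj : ∀ Y : 𝒳.FullSubcategory, Function.Surjective (π.app (op Y))
  exact : ∀ (Y : 𝒳.FullSubcategory) (f : Y.obj ⟶ X₀.obj),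
    π.app (op Y) f = 0 ↔ ∃ g : Y.obj ⟶ X₁.obj, g ≫ d = f

/-- Finitely presented additive contravariant functors on `𝒳`. -/
def IsFP : ObjectProperty (𝒳.FullSubcategoryᵒᵖ ⥤ AddCommGrpCat.{u}) := fun F =>
  F.Additive ∧ Nonempty (Presentation F)

/-- The category `mod-𝒳`. -/
abbrev ModX := (IsFP 𝒳).FullSubcategory

variable {𝒳}

instance additive_of_modX (F : ModX 𝒳) : F.obj.Additive := F.property.1

/-- A chosen presentation. -/
def pres (F : ModX 𝒳) : Presentation F.obj := F.property.2.some

lemma Presentation.π_app {F : 𝒳.FullSubcategoryᵒᵖ ⥤ AddCommGrpCat.{u}} (P : Presentation F)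
    {Y : 𝒳.FullSubcategory} (f : Y.obj ⟶ P.X₀.obj) :
    P.π.app (op Y) f = F.map (ObjectProperty.homMk f : Y ⟶ P.X₀).op
      (P.π.app (op P.X₀) (𝟙 P.X₀.obj)) := by
  have h := ConcreteCategory.congr_hom
    (P.π.naturality (ObjectProperty.homMk f : Y ⟶ P.X₀).op) (𝟙 P.X₀.obj)
  have h2 : (homX 𝒳 P.X₀.obj).map (ObjectProperty.homMk f : Y ⟶ P.X₀).op (𝟙 P.X₀.obj) = f :=
    Category.comp_id f
  refine Eq.trans ?_ h
  exact congrArg (P.π.app (op Y)) h2.symm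

/-- `f : X₀ ⟶ X₀'` lifts `τ` to the chosen presentations. -/
def IsLift {F G : ModX 𝒳} (τ : F ⟶ G) (f : (pres F).X₀.obj ⟶ (pres G).X₀.obj) : Prop :=
  (pres G).π.app (op (pres F).X₀) f =
    τ.hom.app (op (pres F).X₀) ((pres F).π.app (op (pres F).X₀) (𝟙 _))

lemma exists_isLift {F G : ModX 𝒳} (τ : F ⟶ G) : ∃ f, IsLift τ f :=
  (pres G).surj _ _

lemma IsLift.app {F G : ModX 𝒳} {τ : F ⟶ G} {f} (hf : IsLift τ f) {Y : 𝒳.FullSubcategory}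
    (g : Y.obj ⟶ (pres F).X₀.obj) :
    (pres G).π.app (op Y) (g ≫ f) = τ.hom.app (op Y) ((pres F).π.app (op Y) g) := by
  rw [(pres F).π_app g]
  have h1 := ConcreteCategory.congr_hom
    ((pres G).π.naturality (ObjectProperty.homMk g : Y ⟶ (pres F).X₀).op) f
  have h2 := ConcreteCategory.congr_hom
    (τ.hom.naturality (ObjectProperty.homMk g : Y ⟶ (pres F).X₀).op)
      ((pres F).π.app (op (pres F).X₀) (𝟙 _))
  refine Eq.trans h1 (Eq.trans ?_ h2.symm)
  exact congrArg (G.obj.map (ObjectProperty.homMk g : Y ⟶ (pres F).X₀).op) hf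

lemma IsLift.range_le {F G : ModX 𝒳} {τ : F ⟶ G} {f} (hf : IsLift τ f) :
    LinearMap.range (pres F).d.hom.hom ≤
      (LinearMap.range (pres G).d.hom.hom).comap f.hom.hom := by
  have h0 : (pres F).π.app (op (pres F).X₁) (pres F).d = 0 :=
    ((pres F).exact _ _).2 ⟨𝟙 _, Category.id_comp _⟩
  have h1 := hf.app (pres F).d
  rw [h0, map_zero] at h1
  obtain ⟨g, hg⟩ := ((pres G).exact _ _).1 h1
  rintro _ ⟨x, rfl⟩
  refine ⟨g.hom.hom x, ?_⟩
  exact LinearMap.congr_fun (congrArg (fun q => q.hom.hom) hg) x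

/-- `ϑ(F) = Coker(d : X₁ ⟶ X₀)`. -/
def thetaObj (F : ModX 𝒳) : RMod Λ :=
  FGModuleCat.of Λᵐᵒᵖ ((pres F).X₀.obj ⧸ LinearMap.range (pres F).d.hom.hom)

/-- The map of cokernels induced by a lift. -/
def IsLift.map {F G : ModX 𝒳} {τ : F ⟶ G} {f} (hf : IsLift τ f) : thetaObj F ⟶ thetaObj G :=
  FGModuleCat.ofHom (Submodule.mapQ _ _ f.hom.hom hf.range_le)

lemma IsLift.map_eq {F G : ModX 𝒳} {τ : F ⟶ G} {f f'} (hf : IsLift τ f) (hf' : IsLift τ f') :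
    hf.map = hf'.map := by
  have h : (pres G).π.app (op (pres F).X₀) (f - f') = 0 := by
    have := map_sub ((pres G).π.app (op (pres F).X₀)).hom f f'
    refine this.trans ?_
    rw [sub_eq_zero]
    exact hf.trans hf'.symm
  obtain ⟨g, hg⟩ := ((pres G).exact _ _).1 h
  refine FGModuleCat.hom_ext ?_
  refine Submodule.linearMap_qext _ (LinearMap.ext fun x => ?_)
  refine (Submodule.Quotient.eq _).2 ⟨g.hom.hom x, ?_⟩
  exact LinearMap.congr_fun (congrArg (fun q => q.hom.hom) hg) x

variable (𝒳) in
/-- The functor `ϑ : mod-𝒳 ⥤ mod-Λ`, sending `F` with presentation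
`(-, X₁) ⟶ (-, X₀) ⟶ F ⟶ 0` to `Coker(X₁ ⟶ X₀)`. -/
def theta : ModX 𝒳 ⥤ RMod Λ where
  obj := thetaObj
  map τ := (exists_isLift τ).choose_spec.map
  map_id F := by
    have h : IsLift (𝟙 F) (𝟙 _) := rfl
    rw [IsLift.map_eq _ h]
    refine FGModuleCat.hom_ext (Submodule.linearMap_qext _ ?_)
    rfl
  map_comp {F G H} σ τ := by
    obtain ⟨f, hf⟩ := exists_isLift σ
    obtain ⟨g, hg⟩ := exists_isLift τ
    have h : IsLift (σ ≫ τ) (f ≫ g) := by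
      refine (hg.app f).trans ?_
      exact congrArg (τ.hom.app (op (pres F).X₀)) hf
    rw [IsLift.map_eq _ h, IsLift.map_eq _ hf, IsLift.map_eq _ hg]
    refine FGModuleCat.hom_ext (Submodule.linearMap_qext _ ?_)
    rfl

/-- `mod₀-𝒳`: the finitely presented functors that vanish at `Λ`. -/
def mod₀ (hΛ : 𝒳 (regular Λ)) : ObjectProperty (ModX 𝒳) := fun F =>
  Limits.IsZero (F.obj.obj (op ⟨regular Λ, hΛ⟩))

end FinitelyPresentedFunctors
section Auslander

variable {Λ : Type u} [Ring Λ] {𝒳 : ObjectProperty (RMod Λ)}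

/-- The endomorphism ring `End_Λ(X)`; for an additive generator `X` of `𝒳` this is `Aus(𝒳)`. -/
abbrev Aus (X : RMod Λ) : Type u := Module.End Λᵐᵒᵖ X

instance isNoetherian_aus [IsArtinAlgebra Λ] (X : RMod Λ) : IsNoetherianRing (Aus X)ᵐᵒᵖ := by
  obtain ⟨k, _, _, _, _⟩ := IsArtinAlgebra.exists_base (Λ := Λ)
  let _ : Module k X := Module.compHom X (algebraMap k Λᵐᵒᵖ)
  have : IsScalarTower k Λᵐᵒᵖ X := ⟨fun a b x => by
    rw [Algebra.smul_def, mul_smul]; rfl⟩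
  have : SMulCommClass Λᵐᵒᵖ k X := ⟨fun b a x => by
    change b • (algebraMap k Λᵐᵒᵖ a • x) = algebraMap k Λᵐᵒᵖ a • (b • x)
    rw [← mul_smul, ← mul_smul, Algebra.commutes]⟩
  have : SMulCommClass k Λᵐᵒᵖ X := SMulCommClass.symm _ _ _
  have : Module.Finite k X := Module.Finite.trans Λᵐᵒᵖ X
  let ι : Aus X →ₗ[k] (X →ₗ[k] X) :=
    { toFun := fun f => f.restrictScalars k
      map_add' := fun _ _ => rfl
      map_smul' := fun _ _ => rfl }
  have : IsNoetherian k (Aus X) := isNoetherian_of_injective ι fun f g h =>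
    LinearMap.ext fun x => LinearMap.congr_fun h x
  have : IsNoetherian k (Aus X)ᵐᵒᵖ := isNoetherian_of_linearEquiv (MulOpposite.opLinearEquiv k)
  exact isNoetherian_of_tower k this

/-- The endomorphism of `X` in `𝒳` given by an element of `End_Λ(X)`. -/
def toEnd {X : 𝒳.FullSubcategory} (a : Aus X.obj) : X ⟶ X :=
  ObjectProperty.homMk (FGModuleCat.ofHom a)

/-- The value `F(X)`, viewed as a right `End_Λ(X)`-module by `x · a = F(a)(x)`. -/
def EvalMod (F : 𝒳.FullSubcategoryᵒᵖ ⥤ AddCommGrpCat.{u}) (X : 𝒳.FullSubcategory) : Type u :=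
  F.obj (op X)

instance (F : 𝒳.FullSubcategoryᵒᵖ ⥤ AddCommGrpCat.{u}) (X : 𝒳.FullSubcategory) :
    AddCommGroup (EvalMod F X) := inferInstanceAs (AddCommGroup (F.obj (op X)))

instance evalModule (F : 𝒳.FullSubcategoryᵒᵖ ⥤ AddCommGrpCat.{u}) [F.Additive]
    (X : 𝒳.FullSubcategory) : Module (Aus X.obj)ᵐᵒᵖ (EvalMod F X) where
  smul a x := F.map (toEnd a.unop).op x
  one_smul x := ConcreteCategory.congr_hom (F.map_id (op X)) x
  mul_smul a b x := ConcreteCategory.congr_hom (F.map_comp (toEnd b.unop).op (toEnd a.unop).op) x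
  smul_zero a := map_zero (F.map (toEnd a.unop).op).hom
  smul_add a x y := map_add (F.map (toEnd a.unop).op).hom x y
  add_smul a b x := ConcreteCategory.congr_hom
    (F.map_add (f := (toEnd a.unop).op) (g := (toEnd b.unop).op)) x
  zero_smul x := ConcreteCategory.congr_hom (F.map_zero (op X) (op X)) x

/-- A natural transformation evaluated at `X` is `End_Λ(X)`-linear. -/
def evalMap {F G : 𝒳.FullSubcategoryᵒᵖ ⥤ AddCommGrpCat.{u}} [F.Additive] [G.Additive] (τ : F ⟶ G)
    (X : 𝒳.FullSubcategory) : EvalMod F X →ₗ[(Aus X.obj)ᵐᵒᵖ] EvalMod G X where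
  toFun x := τ.app (op X) x
  map_add' x y := map_add (τ.app (op X)).hom x y
  map_smul' a x := ConcreteCategory.congr_hom (τ.naturality (toEnd a.unop).op) x

/-- `X` is an additive generator of `𝒳`, i.e. `𝒳 = add(X)`. -/
def IsAddGenerator (𝒳 : ObjectProperty (RMod Λ)) (X : 𝒳.FullSubcategory) : Prop :=
  𝒳 = addClosure X.obj

lemma IsAddGenerator.exists_retract {X : 𝒳.FullSubcategory} (hX : IsAddGenerator 𝒳 X)
    (Y : 𝒳.FullSubcategory) : ∃ (n : ℕ) (s : Fin n → (Y ⟶ X)) (r : Fin n → (X ⟶ Y)),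
      ∑ i, s i ≫ r i = 𝟙 Y := by
  obtain ⟨n, s, r, h⟩ : addClosure X.obj Y.obj := hX ▸ Y.property
  refine ⟨n,
    fun i => ObjectProperty.homMk (ObjectProperty.homMk (ModuleCat.ofHom (LinearMap.proj i ∘ₗ s))),
    fun i => ObjectProperty.homMk (ObjectProperty.homMk (ModuleCat.ofHom
      (r ∘ₗ LinearMap.single Λᵐᵒᵖ (fun _ : Fin n => (X.obj : Type u)) i))), ?_⟩
  let Φ : (Y ⟶ Y) →+ (Y.obj →ₗ[Λᵐᵒᵖ] Y.obj) :=
    { toFun := fun f => f.hom.hom.hom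
      map_zero' := rfl
      map_add' := fun _ _ => rfl }
  have hΦ : Function.Injective Φ := fun f g hfg =>
    ObjectProperty.hom_ext _ (FGModuleCat.hom_ext hfg)
  apply hΦ
  rw [map_sum]
  refine Eq.trans ?_ h
  refine LinearMap.ext fun y => ?_
  rw [LinearMap.sum_apply]
  change ∑ i, r (Pi.single i (s y i)) = r (s y)
  rw [← map_sum, Finset.univ_sum_single]

/-- For `z ∈ G(Y)`, the additive map `f ↦ G(f)(z)`. -/
def actHom (G : 𝒳.FullSubcategoryᵒᵖ ⥤ AddCommGrpCat.{u}) [G.Additive] {Y : 𝒳.FullSubcategory}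
    (z : G.obj (op Y)) (Z : 𝒳.FullSubcategory) : (Z ⟶ Y) →+ G.obj (op Z) where
  toFun f := G.map f.op z
  map_zero' := ConcreteCategory.congr_hom (G.map_zero (op Y) (op Z)) z
  map_add' f g := ConcreteCategory.congr_hom (G.map_add (f := f.op) (g := g.op)) z

lemma map_comp_apply' (G : 𝒳.FullSubcategoryᵒᵖ ⥤ AddCommGrpCat.{u}) {Y Z W : 𝒳.FullSubcategory}
    (f : W ⟶ Z) (g : Z ⟶ Y) (z : G.obj (op Y)) :
    G.map (f ≫ g).op z = G.map f.op (G.map g.op z) :=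
  ConcreteCategory.congr_hom (G.map_comp g.op f.op) z

lemma eq_sum_retract (G : 𝒳.FullSubcategoryᵒᵖ ⥤ AddCommGrpCat.{u}) [G.Additive]
    {X Y Z : 𝒳.FullSubcategory} {n : ℕ} {s : Fin n → (Y ⟶ X)} {r : Fin n → (X ⟶ Y)}
    (h : ∑ i, s i ≫ r i = 𝟙 Y) (f : Z ⟶ Y) (z : G.obj (op Y)) :
    G.map f.op z = ∑ i, G.map (f ≫ s i).op (G.map (r i).op z) := by
  have h1 : f = ∑ i, (f ≫ s i) ≫ r i := by
    simp_rw [Category.assoc]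
    rw [← Preadditive.comp_sum, h, Category.comp_id]
  have h2 : actHom G z Z f = ∑ i, actHom G z Z ((f ≫ s i) ≫ r i) := by
    rw [← map_sum, ← h1]
  refine h2.trans (Finset.sum_congr rfl fun i _ => ?_)
  exact map_comp_apply' G _ _ z

lemma eq_of_forall_map (G : 𝒳.FullSubcategoryᵒᵖ ⥤ AddCommGrpCat.{u}) [G.Additive]
    {X Y : 𝒳.FullSubcategory} (hX : IsAddGenerator 𝒳 X) {z z' : G.obj (op Y)}
    (hz : ∀ r : X ⟶ Y, G.map r.op z = G.map r.op z') : z = z' := by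
  obtain ⟨n, s, r, h⟩ := hX.exists_retract Y
  have e : ∀ w : G.obj (op Y), w = G.map (𝟙 Y).op w := fun w =>
    (ConcreteCategory.congr_hom (G.map_id (op Y)) w).symm
  rw [e z, e z', eq_sum_retract G h, eq_sum_retract G h]
  exact Finset.sum_congr rfl fun i _ => by rw [hz]

lemma exists_evalMap_eq {X : 𝒳.FullSubcategory} (hX : IsAddGenerator 𝒳 X)
    {F G : 𝒳.FullSubcategoryᵒᵖ ⥤ AddCommGrpCat.{u}} [F.Additive] [G.Additive]
    (φ : EvalMod F X →ₗ[(Aus X.obj)ᵐᵒᵖ] EvalMod G X) : ∃ τ : F ⟶ G, evalMap τ X = φ := by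
  choose n s r h using hX.exists_retract
  let φ' : F.obj (op X) →+ G.obj (op X) := φ.toAddMonoidHom
  have hφ : ∀ (a : X ⟶ X) (x : F.obj (op X)), φ' (F.map a.op x) = G.map a.op (φ' x) :=
    fun a x =>
      φ.map_smul (MulOpposite.op (a.hom.hom.hom : Aus X.obj)) (show EvalMod F X from x)
  let t : ∀ Y : 𝒳.FullSubcategory, F.obj (op Y) →+ G.obj (op Y) := fun Y =>
    ∑ i, (G.map (s Y i).op).hom.comp (φ'.comp (F.map (r Y i).op).hom)
  have ht : ∀ Y y, t Y y = ∑ i, G.map (s Y i).op (φ' (F.map (r Y i).op y)) := fun Y y => by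
    rw [AddMonoidHom.finsetSum_apply]; rfl
  have K : ∀ (Y : 𝒳.FullSubcategory) (q : X ⟶ Y) (y : F.obj (op Y)),
      G.map q.op (t Y y) = φ' (F.map q.op y) := by
    intro Y q y
    rw [ht, map_sum, eq_sum_retract F (h Y) q y, map_sum]
    refine Finset.sum_congr rfl fun i _ => ?_
    rw [hφ, map_comp_apply']
  refine ⟨{ app := fun Y => AddCommGrpCat.ofHom (t Y.unop), naturality := ?_ }, ?_⟩
  · intro Y Z f
    ext y
    change t Z.unop (F.map f y) = G.map f (t Y.unop y)
    refine eq_of_forall_map G hX fun q => ?_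
    rw [K]
    have e1 := map_comp_apply' F q f.unop y
    have e2 := map_comp_apply' G q f.unop (t Y.unop y)
    refine (congrArg φ' e1.symm).trans (Eq.trans ?_ e2)
    exact (K _ _ _).symm
  · refine LinearMap.ext fun x => ?_
    have e : ∀ (H : 𝒳.FullSubcategoryᵒᵖ ⥤ AddCommGrpCat.{u}) (w : H.obj (op X)),
      H.map (𝟙 X).op w = w := fun H w => ConcreteCategory.congr_hom (H.map_id (op X)) w
    exact (e G _).symm.trans ((K X (𝟙 X) x).trans (congrArg φ' (e F x)))

lemma finite_evalMod {X : 𝒳.FullSubcategory} (hX : IsAddGenerator 𝒳 X) (F : ModX 𝒳) :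
    Module.Finite (Aus X.obj)ᵐᵒᵖ (EvalMod F.obj X) := by
  obtain ⟨n, s, r, h⟩ := hX.exists_retract (pres F).X₀
  let z : F.obj.obj (op (pres F).X₀) := (pres F).π.app (op (pres F).X₀) (𝟙 (pres F).X₀.obj)
  let b : Fin n → EvalMod F.obj X := fun i => F.obj.map (r i).op z
  have hb : Submodule.span (Aus X.obj)ᵐᵒᵖ (Set.range b) = ⊤ := by
    rw [eq_top_iff]
    intro y _
    obtain ⟨f, hf⟩ := (pres F).surj X y
    have h1 : (y : F.obj.obj (op X)) =
        ∑ i, F.obj.map ((ObjectProperty.homMk f : X ⟶ (pres F).X₀) ≫ s i).op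
          (F.obj.map (r i).op z) := by
      rw [← eq_sum_retract F.obj h, ← hf]
      exact (pres F).π_app f
    have h2 : y = ∑ i, (MulOpposite.op
        (((ObjectProperty.homMk f : X ⟶ (pres F).X₀) ≫ s i).hom.hom.hom : Aus X.obj)) • b i := h1
    rw [h2]
    exact Submodule.sum_mem _ fun i _ => Submodule.smul_mem _ _ (Submodule.subset_span ⟨i, rfl⟩)
  exact ⟨hb ▸ Submodule.fg_span (Set.finite_range b)⟩

/-- The evaluation functor `e_X : mod-𝒳 ⥤ mod-Aus(𝒳)`, `F ↦ F(X)`. -/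
def evalX {X : 𝒳.FullSubcategory} (hX : IsAddGenerator 𝒳 X) : ModX 𝒳 ⥤ RMod (Aus X.obj) where
  obj F :=
    haveI := finite_evalMod hX F
    FGModuleCat.of (Aus X.obj)ᵐᵒᵖ (EvalMod F.obj X)
  map τ := ObjectProperty.homMk (ModuleCat.ofHom (evalMap τ.hom X))
  map_id _ := rfl
  map_comp _ _ := rfl

instance evalX_faithful {X : 𝒳.FullSubcategory} (hX : IsAddGenerator 𝒳 X) :
    (evalX hX).Faithful where
  map_injective {F G} σ τ h := by
    have h' : evalMap σ.hom X = evalMap τ.hom X :=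
      congrArg (fun q : (evalX hX).obj F ⟶ (evalX hX).obj G => q.hom.hom) h
    refine ObjectProperty.hom_ext _ (NatTrans.ext (funext fun Y => ?_))
    ext y
    refine eq_of_forall_map (Y := Y.unop) G.obj hX fun r => ?_
    have e1 := ConcreteCategory.congr_hom (σ.hom.naturality r.op) y
    have e2 := ConcreteCategory.congr_hom (τ.hom.naturality r.op) y
    exact e1.symm.trans ((LinearMap.congr_fun h' (show EvalMod F.obj X from
      F.obj.map r.op y)).trans e2)

instance evalX_full {X : 𝒳.FullSubcategory} (hX : IsAddGenerator 𝒳 X) : (evalX hX).Full where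
  map_surjective {F G} f := by
    obtain ⟨τ, hτ⟩ := exists_evalMap_eq hX (F := F.obj) (G := G.obj) f.hom.hom
    exact ⟨ObjectProperty.homMk τ, FGModuleCat.hom_ext hτ⟩

/-- The representable functor `(-, Y)` is finitely presented. -/
lemma isFP_homX (Y : 𝒳.FullSubcategory) :
    IsFP 𝒳 (homX 𝒳 Y.obj) := by
  refine ⟨inferInstance, ⟨{
    X₁ := Y
    X₀ := Y
    d := 0
    π := 𝟙 _
    surj := fun _ y => ⟨y, rfl⟩
    exact := fun Z f => ⟨fun hf => ⟨0, ?_⟩, ?_⟩ }⟩⟩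
  · rw [Limits.zero_comp]
    exact Eq.symm hf
  · rintro ⟨g, rfl⟩
    exact Limits.comp_zero (C := RMod Λ) (f := g)

/-- Every finitely generated `Aus(𝒳)`-module is a quotient of some `Hom(X, Y)`, `Y ∈ 𝒳`. -/
lemma exists_surjective {X : 𝒳.FullSubcategory} (hX : IsAddGenerator 𝒳 X) (N : Type u)
    [AddCommGroup N] [Module (Aus X.obj)ᵐᵒᵖ N] [Module.Finite (Aus X.obj)ᵐᵒᵖ N] :
    ∃ (Y : 𝒳.FullSubcategory) (p : EvalMod (homX 𝒳 Y.obj) X →ₗ[(Aus X.obj)ᵐᵒᵖ] N),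
      Function.Surjective p := by
  obtain ⟨n, a, ha⟩ := Module.Finite.exists_fin (R := (Aus X.obj)ᵐᵒᵖ) (M := N)
  let Y₀ : RMod Λ := FGModuleCat.of Λᵐᵒᵖ (Fin n → X.obj)
  have hY : 𝒳 Y₀ := by
    rw [hX]
    exact ⟨n, LinearMap.id, LinearMap.id, rfl⟩
  let c : (X.obj ⟶ Y₀) → Fin n → Aus X.obj := fun f j => LinearMap.proj j ∘ₗ f.hom.hom
  refine ⟨⟨Y₀, hY⟩, { toFun := fun f => ∑ j, MulOpposite.op (c f j) • a j
                      map_add' := fun f g => ?_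
                      map_smul' := fun b f => ?_ }, fun y => ?_⟩
  · rw [← Finset.sum_add_distrib]
    refine Finset.sum_congr rfl fun j _ => ?_
    rw [← add_smul]
    rfl
  · rw [RingHom.id_apply, Finset.smul_sum]
    refine Finset.sum_congr rfl fun j _ => ?_
    rw [← mul_smul]
    rfl
  · have hy : y ∈ Submodule.span (Aus X.obj)ᵐᵒᵖ (Set.range a) := ha ▸ Submodule.mem_top
    obtain ⟨b, hb⟩ := (Submodule.mem_span_range_iff_exists_fun _).1 hy
    exact ⟨FGModuleCat.ofHom (LinearMap.pi fun j => (b j).unop), hb⟩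

/-- The maps `Z ⟶ Y₀` that factor through `d`. -/
def cokRel {Y₁ Y₀ : RMod Λ} (d : Y₁ ⟶ Y₀) (Z : RMod Λ) : AddSubgroup (Z ⟶ Y₀) :=
  (Preadditive.rightComp Z d).range

/-- The cokernel of `(-, d)`. -/
def cokFunctor (𝒳 : ObjectProperty (RMod Λ)) {Y₁ Y₀ : RMod Λ} (d : Y₁ ⟶ Y₀) :
    𝒳.FullSubcategoryᵒᵖ ⥤ AddCommGrpCat.{u} where
  obj Z := AddCommGrpCat.of ((Z.unop.obj ⟶ Y₀) ⧸ cokRel d Z.unop.obj)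
  map {Z W} f := AddCommGrpCat.ofHom (QuotientAddGroup.map (cokRel d Z.unop.obj)
    (cokRel d W.unop.obj) (Preadditive.leftComp Y₀ f.unop.hom) (by
      rintro _ ⟨g, rfl⟩
      exact ⟨f.unop.hom ≫ g, Category.assoc f.unop.hom g d⟩))
  map_id Z := by
    ext x
    exact congrArg (QuotientAddGroup.mk (s := cokRel d Z.unop.obj)) (Category.id_comp x)
  map_comp {Z W V} f g := by
    ext x
    exact congrArg (QuotientAddGroup.mk (s := cokRel d V.unop.obj)) (Category.assoc _ _ x)

lemma isFP_cokFunctor {Y₁ Y₀ : 𝒳.FullSubcategory} (d : Y₁.obj ⟶ Y₀.obj) :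
    IsFP 𝒳 (cokFunctor 𝒳 d) := by
  refine ⟨⟨fun {Z W f g} => ?_⟩, ⟨{
    X₁ := Y₁
    X₀ := Y₀
    d := d
    π := { app := fun Z => AddCommGrpCat.ofHom (QuotientAddGroup.mk' (cokRel d Z.unop.obj)) }
    surj := fun Z => QuotientAddGroup.mk_surjective
    exact := fun Z f => QuotientAddGroup.eq_zero_iff (N := cokRel d Z.obj) f }⟩⟩
  ext x
  obtain ⟨x, rfl⟩ := QuotientAddGroup.mk_surjective x
  exact congrArg (QuotientAddGroup.mk (s := cokRel d W.unop.obj))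
    (Preadditive.add_comp (C := RMod Λ) _ _ _ f.unop.hom g.unop.hom x)

instance evalX_essSurj [IsArtinAlgebra Λ] {X : 𝒳.FullSubcategory} (hX : IsAddGenerator 𝒳 X) :
    (evalX hX).EssSurj where
  mem_essImage N := by
    obtain ⟨Y₀, p, hp⟩ := exists_surjective hX N
    have : Module.Finite (Aus X.obj)ᵐᵒᵖ (EvalMod (homX 𝒳 Y₀.obj) X) :=
      finite_evalMod hX ⟨_, isFP_homX Y₀⟩
    obtain ⟨Y₁, q, hq⟩ := exists_surjective hX (LinearMap.ker p)
    obtain ⟨τ, hτ⟩ := exists_evalMap_eq hX ((LinearMap.ker p).subtype ∘ₗ q)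
    let d : Y₁.obj ⟶ Y₀.obj := τ.app (op Y₁) (𝟙 Y₁.obj)
    have hd : ∀ g : X.obj ⟶ Y₁.obj, g ≫ d = (q g : EvalMod (homX 𝒳 Y₀.obj) X) := by
      intro g
      have h1 := ConcreteCategory.congr_hom
        (τ.naturality (ObjectProperty.homMk g : X ⟶ Y₁).op) (𝟙 Y₁.obj)
      have h2 : (homX 𝒳 Y₁.obj).map (ObjectProperty.homMk g : X ⟶ Y₁).op (𝟙 Y₁.obj) = g :=
        Category.comp_id g
      have h3 : τ.app (op X) g = g ≫ d :=
        (congrArg (τ.app (op X)) h2.symm).trans h1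
      exact h3.symm.trans (LinearMap.congr_fun hτ g)
    let pa : (X.obj ⟶ Y₀.obj) →+ N := p.toAddMonoidHom
    have hker : ∀ f : X.obj ⟶ Y₀.obj, f ∈ cokRel d X.obj ↔ pa f = 0 := by
      intro f
      constructor
      · rintro ⟨g, rfl⟩
        refine (congrArg p (hd g)).trans ?_
        exact LinearMap.mem_ker.1 (q g).2
      · intro hf
        obtain ⟨g, hg⟩ := hq ⟨f, LinearMap.mem_ker.2 hf⟩
        exact ⟨g, (hd g).trans (congrArg Subtype.val hg)⟩
    have : (cokFunctor 𝒳 d).Additive := (isFP_cokFunctor (Y₁ := Y₁) (Y₀ := Y₀) d).1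
    let F : ModX 𝒳 := ⟨_, isFP_cokFunctor (Y₁ := Y₁) (Y₀ := Y₀) d⟩
    let l : ((X.obj ⟶ Y₀.obj) ⧸ cokRel d X.obj) →+ N :=
      QuotientAddGroup.lift (cokRel d X.obj) pa fun f hf => (hker f).1 hf
    let L : EvalMod (cokFunctor 𝒳 d) X →ₗ[(Aus X.obj)ᵐᵒᵖ] N :=
      { toFun := l
        map_add' := l.map_add
        map_smul' := fun a x => by
          obtain ⟨x, rfl⟩ := QuotientAddGroup.mk_surjective x
          exact p.map_smul a x }
    have hL : Function.Bijective L := by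
      constructor
      · refine (injective_iff_map_eq_zero l).2 fun x hx => ?_
        obtain ⟨x, rfl⟩ := QuotientAddGroup.mk_surjective x
        exact (QuotientAddGroup.eq_zero_iff x).2 ((hker x).2 hx)
      · intro y
        obtain ⟨f, hf⟩ := hp y
        exact ⟨QuotientAddGroup.mk (s := cokRel d X.obj) f, hf⟩
    have := finite_evalMod hX F
    exact ⟨F, ⟨LinearEquiv.toFGModuleCatIso (LinearEquiv.ofBijective L hL)⟩⟩

instance evalX_isEquivalence [IsArtinAlgebra Λ] {X : 𝒳.FullSubcategory}
    (hX : IsAddGenerator 𝒳 X) : (evalX hX).IsEquivalence where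

lemma hasImages_modX [IsArtinAlgebra Λ] {X : 𝒳.FullSubcategory} (hX : IsAddGenerator 𝒳 X) :
    Limits.HasImages (ModX 𝒳) := by
  have : Limits.HasFiniteProducts (ModX 𝒳) :=
    ⟨fun _ => Adjunction.hasLimitsOfShape_of_equivalence (evalX hX)⟩
  let _ : Abelian (ModX 𝒳) := abelianOfEquivalence (evalX hX)
  infer_instance

/-- The middle functor `μ = ϑ e⁻¹ : mod-Aus(𝒳) ⥤ mod-Λ` of the recollement `R(𝒳, Γ)`. -/
def mu [IsArtinAlgebra Λ] {X : 𝒳.FullSubcategory} (hX : IsAddGenerator 𝒳 X) :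
    RMod (Aus X.obj) ⥤ RMod Λ :=
  (evalX hX).inv ⋙ theta 𝒳

/-- A recollement `R(𝒳, Λ)`, with middle row `mod₀-𝒳 ⟶ mod-𝒳 ⟶ mod-Λ`. -/
abbrev RecollementX (hΛ : 𝒳 (regular Λ)) := Recollement (mod₀ hΛ).ι (theta 𝒳)

/-- A recollement `R(𝒳, Γ)`, `Γ = Aus(𝒳)`, with middle row `Ker μ ⟶ mod-Γ ⟶ mod-Λ`. -/
abbrev RecollementΓ [IsArtinAlgebra Λ] {X : 𝒳.FullSubcategory} (hX : IsAddGenerator 𝒳 X) :=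
  Recollement (mu hX).kernel.ι (mu hX)

/-- The `Γ`-module `T = ζ^𝒳_X(X)`: the intermediate extension of `X`, evaluated at `X`. -/
def zetaXX [IsArtinAlgebra Λ] {X : 𝒳.FullSubcategory} (hX : IsAddGenerator 𝒳 X)
    {hΛ : 𝒳 (regular Λ)} (R : RecollementX hΛ) : RMod (Aus X.obj) :=
  haveI := hasImages_modX hX
  (evalX hX).obj (R.ζ X.obj)

end Auslander

end RelAus

end

noncomputable section

namespace RelAus

/-! ### The unit F → Hom(-, ϑF) and its values on projectives. -/

section Unit

variable {Λ : Type u} [Ring Λ] {𝒳 : ObjectProperty (RMod Λ)}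

/-! Everything is controlled by one projective Γ-module, P = Hom(X, Λ). Evaluation at X identifies
Hom(X, Y), for Y in 𝒳, with projective Γ-modules, and every finitely generated Γ-module is a
quotient of one of them. Since Λ is projective, F(Λ) ≅ Hom(Λ, ϑF) ≅ ϑF, so Ker μ consists of the G
with Hom(P, G) = 0 (`mu_kernel_iff`). By adjunction Ker L_λ and Ker L_ρ are the left and right
Hom-orthogonals of this class. The left orthogonal consists of the N that equal the trace of P in N
(`ℓlam_kernel_iff_regularTrace_eq_top`).

The module T is the trace of P in Hom(X, X) (`exists_zetaXX_embedding`): ϑ_λ(X) has no maps to Ker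
ϑ, while Coker γ_X lies in Ker ϑ. As Λ is a summand of some X^n, T generates exactly the modules
generated by P, so gen(T) = Ker L_λ.

If N lies in Ker L_ρ, a presentation d : Y₁ → Y can be replaced by the inclusion i : I → Y of its
image: I is in 𝒳, and the failure of Hom(X, Y₁) → Hom(X, I) to be onto is measured by a module in
Ker μ, which cannot map to N. So Hom(X, I) → Hom(X, Y) is a projective resolution of length one.
Conversely, a map from Ker μ to a module with projective first syzygy vanishes by a lifting argument
through a free cover (`linearMap_eq_zero_of_projective_ker`). Being inside the projective Hom(X, X),
T cogenerates only such modules.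

For injective dimension, a left ideal of Γᵐᵒᵖ has a resolution Hom(X, K) → Hom(X, Y) in which Y/K
embeds in X. Maps from Hom(X, K) to a quotient of Hom(X, Λ^n) lift to maps K → Λ^n, which extend to
Y because Ext¹(Y/K, Λ) = 0. Baer's criterion then makes the first cosyzygy injective.

If Λ is self-injective, every finitely generated module embeds in a free one
(`exists_injective_to_free`), so by closure under submodules 𝒳 contains cokernels of embeddings into
free modules. Both reverse inclusions follow by embedding Y in Λ^n and using its cokernel. -/

lemma Presentation.exists_π {F : 𝒳.FullSubcategoryᵒᵖ ⥤ AddCommGrpCat.{u}} (P : Presentation F)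
    {Y : 𝒳.FullSubcategory} (z : F.obj (op Y)) :
    ∃ f : Y.obj ⟶ P.X₀.obj, P.π.app (op Y) f = z :=
  P.surj Y z

/-- The projection `X₀ ⟶ Coker(d) = ϑ(F)`. -/
def thetaProj (F : ModX 𝒳) : (pres F).X₀.obj ⟶ (theta 𝒳).obj F :=
  FGModuleCat.ofHom (Submodule.mkQ (LinearMap.range (pres F).d.hom.hom))

lemma thetaProj_surjective (F : ModX 𝒳) : Function.Surjective (thetaProj F).hom.hom :=
  Submodule.mkQ_surjective _

lemma thetaProj_eq_zero_iff (F : ModX 𝒳) (x : (pres F).X₀.obj) :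
    (thetaProj F).hom.hom x = 0 ↔ x ∈ LinearMap.range (pres F).d.hom.hom :=
  Submodule.Quotient.mk_eq_zero _

lemma d_comp_thetaProj (F : ModX 𝒳) : (pres F).d ≫ thetaProj F = 0 :=
  FGModuleCat.hom_ext (LinearMap.ext fun x => (thetaProj_eq_zero_iff F _).2 ⟨x, rfl⟩)

lemma thetaProj_cancel (F : ModX 𝒳) {M : RMod Λ} {f g : (theta 𝒳).obj F ⟶ M}
    (h : thetaProj F ≫ f = thetaProj F ≫ g) : f = g :=
  FGModuleCat.hom_ext (LinearMap.ext fun x => by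
    obtain ⟨x, rfl⟩ := thetaProj_surjective F x
    exact LinearMap.congr_fun (congrArg (fun q => q.hom.hom) h) x)

lemma thetaProj_comp_map {F G : ModX 𝒳} {τ : F ⟶ G} {f} (hf : IsLift τ f) :
    thetaProj F ≫ (theta 𝒳).map τ = f ≫ thetaProj G := by
  have h : (theta 𝒳).map τ = hf.map := (exists_isLift τ).choose_spec.map_eq hf
  rw [h]
  rfl

/-- The unit `F(Y) ⟶ Hom(Y, ϑF)` of the adjunction between `ϑ` and `M ↦ (-, M)`. -/
def thetaUnit (F : ModX 𝒳) {Y : 𝒳.FullSubcategory} (z : F.obj.obj (op Y)) : Y.obj ⟶ (theta 𝒳).obj F :=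
  ((pres F).exists_π z).choose ≫ thetaProj F

lemma thetaUnit_π (F : ModX 𝒳) {Y : 𝒳.FullSubcategory} (f : Y.obj ⟶ (pres F).X₀.obj) :
    thetaUnit F ((pres F).π.app (op Y) f) = f ≫ thetaProj F := by
  have hs := ((pres F).exists_π ((pres F).π.app (op Y) f)).choose_spec
  have h : (pres F).π.app (op Y)
      (((pres F).exists_π ((pres F).π.app (op Y) f)).choose - f) = 0 := by
    refine (map_sub ((pres F).π.app (op Y)).hom _ _).trans (sub_eq_zero.2 hs)
  obtain ⟨g, hg⟩ := ((pres F).exact _ _).1 h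
  rw [thetaUnit, ← sub_eq_zero, ← Preadditive.sub_comp]
  refine (congrArg (· ≫ thetaProj F) hg.symm).trans ?_
  rw [Category.assoc, d_comp_thetaProj, Limits.comp_zero]

lemma thetaUnit_map (F : ModX 𝒳) {Y Z : 𝒳.FullSubcategory} (g : Z ⟶ Y) (z : F.obj.obj (op Y)) :
    thetaUnit F (F.obj.map g.op z) = g.hom ≫ thetaUnit F z := by
  obtain ⟨f, rfl⟩ := (pres F).exists_π z
  have h := ConcreteCategory.congr_hom ((pres F).π.naturality g.op) f
  have h2 : thetaUnit F (F.obj.map g.op ((pres F).π.app (op Y) f)) =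
      thetaUnit F ((pres F).π.app (op Z) (g.hom ≫ f)) := congrArg (thetaUnit F) h.symm
  rw [h2, thetaUnit_π]
  exact (Category.assoc _ _ _).trans (congrArg (g.hom ≫ ·) (thetaUnit_π F f).symm)

lemma thetaUnit_app {F G : ModX 𝒳} (τ : F ⟶ G) {Y : 𝒳.FullSubcategory} (z : F.obj.obj (op Y)) :
    thetaUnit G (τ.hom.app (op Y) z) = thetaUnit F z ≫ (theta 𝒳).map τ := by
  obtain ⟨f, rfl⟩ := (pres F).exists_π z
  obtain ⟨g, hg⟩ := exists_isLift τ
  rw [← hg.app, thetaUnit_π, thetaUnit_π]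
  rw [Category.assoc, Category.assoc, thetaProj_comp_map hg]

lemma thetaUnit_add (F : ModX 𝒳) {Y : 𝒳.FullSubcategory} (z z' : F.obj.obj (op Y)) :
    thetaUnit F (z + z') = thetaUnit F z + thetaUnit F z' := by
  obtain ⟨f, rfl⟩ := (pres F).exists_π z
  obtain ⟨f', rfl⟩ := (pres F).exists_π z'
  rw [thetaUnit_π, thetaUnit_π, ← Preadditive.add_comp, ← thetaUnit_π]
  exact congrArg (thetaUnit F) (map_add ((pres F).π.app (op Y)).hom f f').symm

lemma thetaUnit_zero (F : ModX 𝒳) (Y : 𝒳.FullSubcategory) :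
    thetaUnit F (0 : F.obj.obj (op Y)) = 0 := by
  have h := thetaUnit_add F (Y := Y) 0 0
  rw [add_zero] at h
  exact left_eq_add.1 h

/-- F(Y) is the cokernel of Hom(Y, X₁) → Hom(Y, X₀), and Hom(Y, -) is exact for projective Y, so it
commutes with forming Coker(d). This one fact yields Ker ϑ = mod₀-𝒳, the invertible counit and the
left adjoint of ϑ. -/
lemma thetaUnit_bijective (F : ModX 𝒳) {Y : 𝒳.FullSubcategory} (hY : prj Λ Y.obj) :
    Function.Bijective (thetaUnit F (Y := Y)) := by
  have : Module.Projective Λᵐᵒᵖ Y.obj := hY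
  constructor
  · let ψ : F.obj.obj (op Y) →+ (Y.obj ⟶ (theta 𝒳).obj F) := AddMonoidHom.mk' _ (thetaUnit_add F)
    refine (injective_iff_map_eq_zero ψ).2 fun z hz => ?_
    obtain ⟨f, rfl⟩ := (pres F).exists_π z
    have hz : f ≫ thetaProj F = 0 := (thetaUnit_π F f).symm.trans hz
    have hr : ∀ y, f.hom.hom y ∈ LinearMap.range (pres F).d.hom.hom := fun y =>
      (thetaProj_eq_zero_iff F _).1 (LinearMap.congr_fun (congrArg (fun q => q.hom.hom) hz) y)
    obtain ⟨g, hg⟩ := Module.projective_lifting_property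
      (pres F).d.hom.hom.rangeRestrict (f.hom.hom.codRestrict _ hr)
      (LinearMap.surjective_rangeRestrict _)
    refine ((pres F).exact _ _).2 ⟨FGModuleCat.ofHom g, FGModuleCat.hom_ext ?_⟩
    ext y
    exact congrArg Subtype.val (LinearMap.congr_fun hg y)
  · intro φ
    obtain ⟨g, hg⟩ := Module.projective_lifting_property (thetaProj F).hom.hom φ.hom.hom
      (thetaProj_surjective F)
    refine ⟨(pres F).π.app (op Y) (FGModuleCat.ofHom g), (thetaUnit_π F _).trans ?_⟩
    exact FGModuleCat.hom_ext hg

end Unit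

/-! ### Natural transformations out of a presented functor. -/

section HomFromPresented

variable {Λ : Type u} [Ring Λ] {𝒳 : ObjectProperty (RMod Λ)}

/-- A natural transformation out of a presented functor can be prescribed on the generator. -/
lemma Presentation.exists_hom {F G : 𝒳.FullSubcategoryᵒᵖ ⥤ AddCommGrpCat.{u}} [G.Additive]
    (P : Presentation F) (z : G.obj (op P.X₀))
    (hz : G.map (ObjectProperty.homMk P.d : P.X₁ ⟶ P.X₀).op z = 0) :
    ∃ τ : F ⟶ G, τ.app (op P.X₀) (P.π.app (op P.X₀) (𝟙 P.X₀.obj)) = z := by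
  -- Two lifts of the same element of F(Y) differ by a map through d, which G sends to zero on z;
  -- hence the value does not depend on the lift.
  have key : ∀ (Y : 𝒳.FullSubcategory) (f g : Y.obj ⟶ P.X₀.obj),
      P.π.app (op Y) f = P.π.app (op Y) g →
      G.map (ObjectProperty.homMk f : Y ⟶ P.X₀).op z =
        G.map (ObjectProperty.homMk g : Y ⟶ P.X₀).op z := by
    intro Y f g h
    have h0 : P.π.app (op Y) (f - g) = 0 :=
      (map_sub (P.π.app (op Y)).hom f g).trans (sub_eq_zero.2 h)
    obtain ⟨k, hk⟩ := (P.exact _ _).1 h0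
    have e : (ObjectProperty.homMk f : Y ⟶ P.X₀) - (ObjectProperty.homMk g : Y ⟶ P.X₀) =
        (ObjectProperty.homMk k : Y ⟶ P.X₁) ≫ (ObjectProperty.homMk P.d : P.X₁ ⟶ P.X₀) :=
      ObjectProperty.hom_ext _ hk.symm
    have h1 := map_sub (actHom G z Y) (ObjectProperty.homMk f) (ObjectProperty.homMk g)
    rw [e] at h1
    have h2 : actHom G z Y ((ObjectProperty.homMk k : Y ⟶ P.X₁) ≫
        (ObjectProperty.homMk P.d : P.X₁ ⟶ P.X₀)) = 0 := by
      refine (map_comp_apply' G _ _ z).trans ?_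
      rw [hz]
      exact map_zero (G.map _).hom
    exact sub_eq_zero.1 (h1.symm.trans h2)
  choose s hs using fun Y => P.exists_π (Y := Y)
  let t : ∀ Y : 𝒳.FullSubcategory, F.obj (op Y) →+ G.obj (op Y) := fun Y =>
    AddMonoidHom.mk' (fun x => G.map (ObjectProperty.homMk (s Y x) : Y ⟶ P.X₀).op z) (by
      intro a b
      have h1 := map_add (actHom G z Y) (ObjectProperty.homMk (s Y a))
        (ObjectProperty.homMk (s Y b))
      refine Eq.trans ?_ h1
      refine key Y _ (s Y a + s Y b) ?_
      refine (hs Y (a + b)).trans ?_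
      refine Eq.trans ?_ (map_add (P.π.app (op Y)).hom (s Y a) (s Y b)).symm
      exact congrArg₂ (· + ·) (hs Y a).symm (hs Y b).symm)
  have ht : ∀ (Y : 𝒳.FullSubcategory) (f : Y.obj ⟶ P.X₀.obj), t Y (P.π.app (op Y) f) =
      G.map (ObjectProperty.homMk f : Y ⟶ P.X₀).op z := fun Y f => key Y _ _ (hs Y _)
  refine ⟨{ app := fun Y => AddCommGrpCat.ofHom (t Y.unop), naturality := ?_ }, ?_⟩
  · intro Y Z f
    ext x
    obtain ⟨g, rfl⟩ := P.exists_π (Y := Y.unop) x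
    have e1 := ConcreteCategory.congr_hom (P.π.naturality f) g
    change t Z.unop (F.map f (P.π.app Y g)) = G.map f (t Y.unop (P.π.app Y g))
    refine (congrArg (t Z.unop) e1.symm).trans ?_
    refine (ht Z.unop (f.unop.hom ≫ g)).trans ?_
    refine (map_comp_apply' G f.unop (ObjectProperty.homMk g : Y.unop ⟶ P.X₀) z).trans ?_
    exact congrArg (G.map f) (ht Y.unop g).symm
  · refine (ht P.X₀ (𝟙 _)).trans ?_
    exact ConcreteCategory.congr_hom (G.map_id (op P.X₀)) z

lemma Presentation.app_π {F G : 𝒳.FullSubcategoryᵒᵖ ⥤ AddCommGrpCat.{u}} (P : Presentation F)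
    (τ : F ⟶ G) {Y : 𝒳.FullSubcategory} (f : Y.obj ⟶ P.X₀.obj) :
    τ.app (op Y) (P.π.app (op Y) f) = G.map (ObjectProperty.homMk f : Y ⟶ P.X₀).op
      (τ.app (op P.X₀) (P.π.app (op P.X₀) (𝟙 P.X₀.obj))) := by
  rw [P.π_app f]
  exact ConcreteCategory.congr_hom (τ.naturality (ObjectProperty.homMk f : Y ⟶ P.X₀).op) _

lemma Presentation.hom_ext {F G : 𝒳.FullSubcategoryᵒᵖ ⥤ AddCommGrpCat.{u}} (P : Presentation F)
    {σ τ : F ⟶ G} (h : σ.app (op P.X₀) (P.π.app (op P.X₀) (𝟙 P.X₀.obj)) =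
      τ.app (op P.X₀) (P.π.app (op P.X₀) (𝟙 P.X₀.obj))) : σ = τ := by
  refine NatTrans.ext (funext fun Y => ?_)
  ext x
  obtain ⟨f, rfl⟩ := P.exists_π (Y := Y.unop) x
  exact (P.app_π σ f).trans ((congrArg _ h).trans (P.app_π τ f).symm)

lemma Presentation.map_d_app {F G : 𝒳.FullSubcategoryᵒᵖ ⥤ AddCommGrpCat.{u}} (P : Presentation F)
    (τ : F ⟶ G) : G.map (ObjectProperty.homMk P.d : P.X₁ ⟶ P.X₀).op
      (τ.app (op P.X₀) (P.π.app (op P.X₀) (𝟙 P.X₀.obj))) = 0 := by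
  rw [← P.app_π τ P.d, (P.exact _ _).2 ⟨𝟙 _, Category.id_comp _⟩]
  exact map_zero (τ.app _).hom

end HomFromPresented

/-! ### Elementary tools for finitely generated modules. -/

section Artin

variable (Λ : Type u) [Ring Λ] [IsArtinAlgebra Λ]

instance isArtinianRing_op : IsArtinianRing Λᵐᵒᵖ := by
  obtain ⟨k, _, _, _, _⟩ := IsArtinAlgebra.exists_base (Λ := Λ)
  have : Module.Finite k Λᵐᵒᵖ := Module.Finite.equiv (MulOpposite.opLinearEquiv k)
  exact isArtinian_of_tower k (inferInstance : IsArtinian k Λᵐᵒᵖ)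

end Artin

section LinearMaps

variable {R : Type*} [Ring R] {L M N : Type*} [AddCommGroup L] [AddCommGroup M] [AddCommGroup N]
  [Module R L] [Module R M] [Module R N]

/-- A linear map vanishing on the kernel of a surjection descends. -/
lemma exists_linear_desc {p : L →ₗ[R] M} (hp : Function.Surjective p) (f : L →ₗ[R] N)
    (h : ∀ x, p x = 0 → f x = 0) : ∃ g : M →ₗ[R] N, g ∘ₗ p = f := by
  refine ⟨((LinearMap.ker p).liftQ f fun x hx => h x hx) ∘ₗ
      (p.quotKerEquivOfSurjective hp).symm.toLinearMap, LinearMap.ext fun x => ?_⟩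
  have : (p.quotKerEquivOfSurjective hp).symm (p x) = Submodule.Quotient.mk x := by
    rw [LinearEquiv.symm_apply_eq]
    rfl
  exact congrArg ((LinearMap.ker p).liftQ f fun x hx => h x hx) this

/-- A linear map landing in the range of an injection lifts. -/
lemma exists_linear_lift {i : M →ₗ[R] N} (hi : Function.Injective i) (f : L →ₗ[R] N)
    (h : ∀ x, f x ∈ LinearMap.range i) : ∃ g : L →ₗ[R] M, i ∘ₗ g = f :=
  ⟨(LinearEquiv.ofInjective i hi).symm.toLinearMap ∘ₗ f.codRestrict _ h, LinearMap.ext fun x =>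
    congrArg Subtype.val ((LinearEquiv.ofInjective i hi).apply_symm_apply (f.codRestrict _ h x))⟩

end LinearMaps

section Maps

variable {Λ : Type u} [Ring Λ]

lemma mono_of_injective {M N : RMod Λ} (f : M ⟶ N) (hf : Function.Injective f.hom.hom) :
    Mono f where
  right_cancellation _ _ e := FGModuleCat.hom_ext (LinearMap.ext fun x =>
    hf (LinearMap.congr_fun (congrArg (fun q => q.hom.hom) e) x))

lemma hom_apply_eq {M N : RMod Λ} {f g : M ⟶ N} (h : f = g) (x : M) :
    f.hom.hom x = g.hom.hom x := by rw [h]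

lemma comp_cancel_of_surjective {L M N : RMod Λ} {p : L ⟶ M} (hp : Function.Surjective p.hom.hom)
    {f g : M ⟶ N} (h : p ≫ f = p ≫ g) : f = g :=
  FGModuleCat.hom_ext (LinearMap.ext fun x => by
    obtain ⟨x, rfl⟩ := hp x
    exact hom_apply_eq h x)

/-- A map vanishing on the kernel of a surjection descends. -/
lemma exists_desc {L M N : RMod Λ} {p : L ⟶ M} (hp : Function.Surjective p.hom.hom) (f : L ⟶ N)
    (h : ∀ x, p.hom.hom x = 0 → f.hom.hom x = 0) : ∃ g : M ⟶ N, p ≫ g = f := by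
  obtain ⟨g, hg⟩ := exists_linear_desc hp f.hom.hom h
  exact ⟨ObjectProperty.homMk (ModuleCat.ofHom g), FGModuleCat.hom_ext hg⟩

/-- A map landing in the range of an injection lifts. -/
lemma exists_lift_of_injective {L M N : RMod Λ} {i : M ⟶ N} (hi : Function.Injective i.hom.hom)
    (f : L ⟶ N) (h : ∀ x, f.hom.hom x ∈ LinearMap.range i.hom.hom) : ∃ g : L ⟶ M, g ≫ i = f := by
  obtain ⟨g, hg⟩ := exists_linear_lift hi f.hom.hom h
  exact ⟨ObjectProperty.homMk (ModuleCat.ofHom g), FGModuleCat.hom_ext hg⟩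

/-- A map out of a projective lifts along a map whose range contains its range. -/
lemma exists_lift_of_prj {L M N : RMod Λ} (hL : prj Λ L) (d : M ⟶ N) (f : L ⟶ N)
    (h : ∀ x, f.hom.hom x ∈ LinearMap.range d.hom.hom) : ∃ g : L ⟶ M, g ≫ d = f := by
  have : Module.Projective Λᵐᵒᵖ L := hL
  obtain ⟨g, hg⟩ := Module.projective_lifting_property (P := L)
    d.hom.hom.rangeRestrict (f.hom.hom.codRestrict _ h) (LinearMap.surjective_rangeRestrict _)
  refine ⟨FGModuleCat.ofHom g, FGModuleCat.hom_ext ?_⟩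
  ext y
  exact congrArg Subtype.val (LinearMap.congr_fun hg y)

/-- The map `Λ ⟶ M` sending `1` to `x`. -/
def ofElement {M : RMod Λ} (x : M) : regular Λ ⟶ M :=
  FGModuleCat.ofHom
    { toFun := fun a => MulOpposite.op a • x
      map_add' := fun a b => by rw [MulOpposite.op_add, add_smul]
      map_smul' := fun a b => by
        rw [RingHom.id_apply, ← mul_smul]
        rfl }

lemma ofElement_one {M : RMod Λ} (x : M) : (ofElement x).hom.hom (1 : Λ) = x :=
  one_smul _ x

lemma regular_hom_ext {M : RMod Λ} {f g : regular Λ ⟶ M}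
    (h : f.hom.hom (1 : Λ) = g.hom.hom (1 : Λ)) : f = g := by
  refine FGModuleCat.hom_ext (LinearMap.ext fun a => ?_)
  have e : (a : Λ) = MulOpposite.op a • (1 : Λ) := by simp
  change f.hom.hom (a : Λ) = g.hom.hom (a : Λ)
  rw [e, map_smul, map_smul, h]

/-- The free right module of rank `n`. -/
abbrev free (Λ : Type u) [Ring Λ] (n : ℕ) : RMod Λ := FGModuleCat.of Λᵐᵒᵖ (Fin n → Λ)

lemma prj_free (n : ℕ) : prj Λ (free Λ n) := by
  have : Module.Projective Λᵐᵒᵖ Λ := prj_regular Λ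
  have : Module.Projective Λᵐᵒᵖ (Fin n → Λ) :=
    Module.Projective.of_equiv (DFinsupp.linearEquivFunOnFintype (R := Λᵐᵒᵖ) (ι := Fin n)
      (M := fun _ => Λ))
  exact this

lemma exists_free_surjective (M : RMod Λ) :
    ∃ (n : ℕ) (p : free Λ n ⟶ M), Function.Surjective p.hom.hom := by
  obtain ⟨n, a, ha⟩ := Module.Finite.exists_fin (R := Λᵐᵒᵖ) (M := M)
  refine ⟨n, ObjectProperty.homMk (ModuleCat.ofHom
    (∑ i, (ofElement (a i)).hom.hom ∘ₗ LinearMap.proj (φ := fun _ : Fin n => Λ) i)), fun y => ?_⟩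
  have hy : y ∈ Submodule.span Λᵐᵒᵖ (Set.range a) := ha ▸ Submodule.mem_top
  obtain ⟨b, hb⟩ := (Submodule.mem_span_range_iff_exists_fun _).1 hy
  refine ⟨fun i => (b i).unop, ?_⟩
  refine Eq.trans ?_ hb
  refine (LinearMap.sum_apply _ _ _).trans ?_
  rfl

end Maps

/-! ### The right adjoint M ↦ Hom(-, M) of ϑ. -/

section Adjoints

variable {Λ : Type u} [Ring Λ] {𝒳 : ObjectProperty (RMod Λ)}

lemma prop_of_injective (hsub : 𝒳.IsClosedUnderSubobjects) {M N : RMod Λ} (f : M ⟶ N)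
    (hf : Function.Injective f.hom.hom) (hN : 𝒳 N) : 𝒳 M :=
  have := mono_of_injective f hf
  hsub.prop_of_mono f hN

/-- A right 𝒳-approximation Y → M is onto after applying Hom(Z, -) for Z in 𝒳, and its kernel is
again in 𝒳 as a submodule of Y; these two objects present Hom(-, M). -/
lemma isFP_homX_of_contravariantlyFinite [IsArtinAlgebra Λ] (hcf : ContravariantlyFinite 𝒳)
    (hsub : 𝒳.IsClosedUnderSubobjects) (M : RMod Λ) : IsFP 𝒳 (homX 𝒳 M) := by
  obtain ⟨Y, p, hY, hp⟩ := hcf M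
  let K : RMod Λ := FGModuleCat.of Λᵐᵒᵖ (LinearMap.ker p.hom.hom)
  let i : K ⟶ Y := FGModuleCat.ofHom (LinearMap.ker p.hom.hom).subtype
  have hi : Function.Injective i.hom.hom := Subtype.val_injective
  refine ⟨inferInstance, ⟨{
    X₁ := ⟨K, prop_of_injective hsub i hi hY⟩
    X₀ := ⟨Y, hY⟩
    d := i
    π := Functor.whiskerLeft 𝒳.ι.op (preadditiveYoneda.map p)
    surj := fun Z g => hp Z.obj g Z.property
    exact := fun Z f => ⟨fun hf => ?_, ?_⟩ }⟩⟩
  · have hf : f ≫ p = 0 := hf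
    exact exists_lift_of_injective hi f fun x => ⟨⟨f.hom.hom x, hom_apply_eq hf x⟩, rfl⟩
  · rintro ⟨g, rfl⟩
    change (g ≫ i) ≫ p = 0
    refine FGModuleCat.hom_ext (LinearMap.ext fun x => ?_)
    exact LinearMap.mem_ker.1 (g.hom.hom x).2

/-- The right adjoint `M ↦ (-, M)` of `ϑ`. -/
def thetaRho (hFP : ∀ M, IsFP 𝒳 (homX 𝒳 M)) : RMod Λ ⥤ ModX 𝒳 where
  obj M := ⟨homX 𝒳 M, hFP M⟩
  map f := ObjectProperty.homMk (Functor.whiskerLeft 𝒳.ι.op (preadditiveYoneda.map f))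

instance thetaRho_additive (hFP : ∀ M, IsFP 𝒳 (homX 𝒳 M)) : (thetaRho hFP).Additive where
  map_add {M N f g} := by
    refine ObjectProperty.hom_ext _ (NatTrans.ext (funext fun Y => ?_))
    ext z
    exact Preadditive.comp_add (C := RMod Λ) _ _ _ z f g

/-- A map `ϑF ⟶ M` gives a natural transformation `F ⟶ (-, M)`. -/
def toThetaRho (hFP : ∀ M, IsFP 𝒳 (homX 𝒳 M)) {F : ModX 𝒳} {M : RMod Λ}
    (g : (theta 𝒳).obj F ⟶ M) : F ⟶ (thetaRho hFP).obj M :=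
  ObjectProperty.homMk
    { app := fun Y => AddCommGrpCat.ofHom (AddMonoidHom.mk'
        (fun z : F.obj.obj (op Y.unop) => (thetaUnit F z ≫ g : Y.unop.obj ⟶ M)) fun a b => by
          exact (congrArg (· ≫ g) (thetaUnit_add F a b)).trans (Preadditive.add_comp _ _ _ _ _ _))
      naturality := fun Y Z f => by
        ext z
        have h := thetaUnit_map F f.unop z
        refine (congrArg (· ≫ g) h).trans ?_
        exact Category.assoc _ _ _ }

lemma toThetaRho_app (hFP : ∀ M, IsFP 𝒳 (homX 𝒳 M)) {F : ModX 𝒳} {M : RMod Λ}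
    (g : (theta 𝒳).obj F ⟶ M) {Y : 𝒳.FullSubcategory} (z : F.obj.obj (op Y)) :
    (toThetaRho hFP g).hom.app (op Y) z = thetaUnit F z ≫ g := rfl

lemma toThetaRho_generator (hFP : ∀ M, IsFP 𝒳 (homX 𝒳 M)) {F : ModX 𝒳} {M : RMod Λ}
    (g : (theta 𝒳).obj F ⟶ M) :
    (toThetaRho hFP g).hom.app (op (pres F).X₀) ((pres F).π.app (op (pres F).X₀) (𝟙 (pres F).X₀.obj)) =
      thetaProj F ≫ g := by
  exact (congrArg (· ≫ g) (thetaUnit_π F _)).trans (congrArg (· ≫ g) (Category.id_comp _))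

/-- Both sides amount to maps X₀ → M that kill d. -/
lemma toThetaRho_bijective (hFP : ∀ M, IsFP 𝒳 (homX 𝒳 M)) (F : ModX 𝒳) (M : RMod Λ) :
    Function.Bijective (toThetaRho hFP (F := F) (M := M)) := by
  constructor
  · intro g g' h
    apply thetaProj_cancel
    exact (toThetaRho_generator hFP g).symm.trans ((congrArg (fun τ : F ⟶ (thetaRho hFP).obj M =>
      τ.hom.app (op (pres F).X₀) ((pres F).π.app (op (pres F).X₀) (𝟙 (pres F).X₀.obj))) h).trans
        (toThetaRho_generator hFP g'))
  · intro τ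
    let z : (pres F).X₀.obj ⟶ M :=
      τ.hom.app (op (pres F).X₀) ((pres F).π.app (op (pres F).X₀) (𝟙 (pres F).X₀.obj))
    have hz : (pres F).d ≫ z = 0 := (pres F).map_d_app τ.hom
    obtain ⟨g, hg⟩ := exists_desc (thetaProj_surjective F) z fun x hx => by
      obtain ⟨y, rfl⟩ := (thetaProj_eq_zero_iff F x).1 hx
      exact hom_apply_eq hz y
    refine ⟨g, ObjectProperty.hom_ext _ ((pres F).hom_ext ?_)⟩
    exact (toThetaRho_generator hFP g).trans hg

/-- `ϑ` is left adjoint to `M ↦ (-, M)`. -/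
def thetaAdjRho (hFP : ∀ M, IsFP 𝒳 (homX 𝒳 M)) : theta 𝒳 ⊣ thetaRho hFP :=
  Adjunction.mkOfHomEquiv
    { homEquiv := fun F M => Equiv.ofBijective _ (toThetaRho_bijective hFP F M)
      homEquiv_naturality_left_symm := fun {F F' M} τ g => by
        obtain ⟨g, rfl⟩ := (toThetaRho_bijective hFP F' M).2 g
        have e := (Equiv.ofBijective _ (toThetaRho_bijective hFP F' M)).symm_apply_apply g
        rw [Equiv.ofBijective_apply] at e
        rw [e, Equiv.symm_apply_eq, Equiv.ofBijective_apply]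
        refine ObjectProperty.hom_ext _ (NatTrans.ext (funext fun Y => ?_))
        ext z
        have h := thetaUnit_app τ (Y := Y.unop) z
        exact (congrArg (· ≫ g) h).trans (Category.assoc _ _ _)
      homEquiv_naturality_right := fun {F M M'} f g => by
        refine ObjectProperty.hom_ext _ (NatTrans.ext (funext fun Y => ?_))
        ext z
        exact (Category.assoc (thetaUnit F (Y := Y.unop) z) f g).symm }

lemma theta_additive (hFP : ∀ M, IsFP 𝒳 (homX 𝒳 M)) : (theta 𝒳).Additive :=
  (thetaAdjRho hFP).left_adjoint_additive

end Adjoints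

/-! ### Building a recollement from an adjoint triple. -/

section GenericRecollement

variable {A : Type u₂} {A'' : Type u₃} [Category.{v₂} A] [Category.{v₃} A''] [Abelian A]
  [Preadditive A''] {ϑ : A ⥤ A''} {lam rho : A'' ⥤ A}

/-- The triangle identity makes ϑ(counit) a split epimorphism, so ϑ kills the cokernel projection;
as a left adjoint ϑ preserves epimorphisms, so the cokernel itself goes to zero. -/
lemma kernel_cokernel_counit [ϑ.Additive] (adjlam : lam ⊣ ϑ) (adjrho : ϑ ⊣ rho) (F : A) :
    ϑ.kernel (Limits.cokernel (adjlam.counit.app F)) := by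
  have : ϑ.IsLeftAdjoint := ⟨_, ⟨adjrho⟩⟩
  have h : ϑ.map (Limits.cokernel.π (adjlam.counit.app F)) = 0 := by
    have e : ϑ.map (adjlam.counit.app F) ≫
        ϑ.map (Limits.cokernel.π (adjlam.counit.app F)) = 0 := by
      rw [← ϑ.map_comp, Limits.cokernel.condition, ϑ.map_zero]
    have e' := adjlam.right_triangle_components F =≫
      ϑ.map (Limits.cokernel.π (adjlam.counit.app F))
    rw [Category.assoc, e, Limits.comp_zero] at e'
    exact ((Category.id_comp _).symm.trans e'.symm)
  exact Limits.IsZero.of_epi_eq_zero _ h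

lemma kernel_kernel_unit [ϑ.Additive] (adjlam : lam ⊣ ϑ) (adjrho : ϑ ⊣ rho) (F : A) :
    ϑ.kernel (Limits.kernel (adjrho.unit.app F)) := by
  have : ϑ.IsRightAdjoint := ⟨_, ⟨adjlam⟩⟩
  have h : ϑ.map (Limits.kernel.ι (adjrho.unit.app F)) = 0 := by
    have e : ϑ.map (Limits.kernel.ι (adjrho.unit.app F)) ≫ ϑ.map (adjrho.unit.app F) = 0 := by
      rw [← ϑ.map_comp, Limits.kernel.condition, ϑ.map_zero]
    have e' := ϑ.map (Limits.kernel.ι (adjrho.unit.app F)) ≫=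
      adjrho.left_triangle_components F
    rw [← Category.assoc, e, Limits.zero_comp] at e'
    exact ((Category.comp_id _).symm.trans e'.symm)
  exact Limits.IsZero.of_mono_eq_zero _ h

/-- The left adjoint of the inclusion is F ↦ Coker(ϑ_λϑF → F): a map F → G with ϑG = 0 kills the
counit, because maps ϑ_λϑF → G correspond to maps ϑF → ϑG = 0. -/
lemma isRightAdjoint_kernel_ι [ϑ.Additive] (adjlam : lam ⊣ ϑ) (adjrho : ϑ ⊣ rho) :
    ϑ.kernel.ι.IsRightAdjoint := by
  let L : A → ϑ.kernel.FullSubcategory := fun F => ⟨_, kernel_cokernel_counit adjlam adjrho F⟩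
  have hb : ∀ (F : A) (G : ϑ.kernel.FullSubcategory), Function.Bijective
      (fun f : L F ⟶ G => (Limits.cokernel.π (adjlam.counit.app F) ≫ f.hom : F ⟶ G.obj)) := by
    refine fun F G => ⟨fun f g h => ?_, fun f => ?_⟩
    · exact ObjectProperty.hom_ext _ ((cancel_epi _).1 h)
    · have hf : adjlam.counit.app F ≫ f = 0 :=
        (adjlam.homEquiv _ _).injective (G.property.eq_of_tgt _ _)
      exact ⟨ObjectProperty.homMk (Limits.cokernel.desc _ f hf), Limits.cokernel.π_desc _ _ _⟩
  exact ⟨_, ⟨Adjunction.adjunctionOfEquivLeft (G := ϑ.kernel.ι)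
    (fun F G => Equiv.ofBijective _ (hb F G)) fun F G G' g h => (Category.assoc _ _ _).symm⟩⟩

/-- Dual construction: the right adjoint is F ↦ Ker(F → ϑ_ρϑF). -/
lemma isLeftAdjoint_kernel_ι [ϑ.Additive] (adjlam : lam ⊣ ϑ) (adjrho : ϑ ⊣ rho) :
    ϑ.kernel.ι.IsLeftAdjoint := by
  let L : A → ϑ.kernel.FullSubcategory := fun F => ⟨_, kernel_kernel_unit adjlam adjrho F⟩
  have hb : ∀ (G : ϑ.kernel.FullSubcategory) (F : A), Function.Bijective
      (fun f : G ⟶ L F => (f.hom ≫ Limits.kernel.ι (adjrho.unit.app F) : G.obj ⟶ F)) := by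
    refine fun G F => ⟨fun f g h => ?_, fun f => ?_⟩
    · exact ObjectProperty.hom_ext _ ((cancel_mono _).1 h)
    · have hf : f ≫ adjrho.unit.app F = 0 :=
        (adjrho.homEquiv _ _).symm.injective (G.property.eq_of_src _ _)
      exact ⟨ObjectProperty.homMk (Limits.kernel.lift _ f hf), Limits.kernel.lift_ι _ _ _⟩
  exact ⟨_, ⟨Adjunction.adjunctionOfEquivRight (F := ϑ.kernel.ι)
    (fun G F => (Equiv.ofBijective _ (hb G F)).symm) fun G G' F g h => by
      rw [Equiv.symm_apply_eq]
      obtain ⟨h, rfl⟩ := (hb G' F).2 h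
      have e := (Equiv.ofBijective _ (hb G' F)).symm_apply_apply h
      rw [Equiv.ofBijective_apply] at e
      rw [e]
      exact (Category.assoc _ _ _).symm⟩⟩

/-- An additive functor between abelian categories with both adjoints, the right one fully
faithful, is the right half of a recollement. -/
theorem nonempty_recollement_of_adjoints [ϑ.Additive] (adjlam : lam ⊣ ϑ) (adjrho : ϑ ⊣ rho)
    [rho.Full] [rho.Faithful] : Nonempty (Recollement ϑ.kernel.ι ϑ) := by
  have := isRightAdjoint_kernel_ι adjlam adjrho
  have := isLeftAdjoint_kernel_ι adjlam adjrho
  have hlam : lam.FullyFaithful := (Adjunction.Triple.mk adjlam adjrho).fullyFaithfulEquiv.symm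
    (Functor.FullyFaithful.ofFullyFaithful rho)
  have hι : ϑ.kernel.ι.Additive := inferInstance
  exact ⟨{
    ℓlam := ϑ.kernel.ι.leftAdjoint
    ℓrho := ϑ.kernel.ι.rightAdjoint
    ϑlam := lam
    ϑrho := rho
    additive_ℓ := hι
    additive_ϑ := inferInstance
    additive_ℓlam := (Adjunction.ofIsRightAdjoint ϑ.kernel.ι).left_adjoint_additive
    additive_ℓrho := (Adjunction.ofIsLeftAdjoint ϑ.kernel.ι).right_adjoint_additive
    additive_ϑlam := adjlam.left_adjoint_additive
    additive_ϑrho := adjrho.right_adjoint_additive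
    adjℓlam := Adjunction.ofIsRightAdjoint ϑ.kernel.ι
    adjℓrho := Adjunction.ofIsLeftAdjoint ϑ.kernel.ι
    adjϑlam := adjlam
    adjϑrho := adjrho
    full_ℓ := inferInstance
    faithful_ℓ := inferInstance
    full_ϑlam := hlam.full
    faithful_ϑlam := hlam.faithful
    full_ϑrho := inferInstance
    faithful_ϑrho := inferInstance
    im_eq_ker := by
      ext F
      refine ⟨?_, fun hF => ⟨⟨F, hF⟩, ⟨Iso.refl F⟩⟩⟩
      rintro ⟨G, ⟨i⟩⟩
      exact ϑ.kernel.prop_of_iso i G.property }⟩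

end GenericRecollement

/-! ### Existence of the two recollements. -/

section Existence

variable {Λ : Type u} [Ring Λ] {𝒳 : ObjectProperty (RMod Λ)}

lemma isZero_iff {M : RMod Λ} : Limits.IsZero M ↔ ∀ x : M, x = 0 := by
  constructor
  · intro h x
    exact hom_apply_eq (h.eq_of_src (𝟙 M) 0) x
  · intro h
    rw [Limits.IsZero.iff_id_eq_zero]
    exact FGModuleCat.hom_ext (LinearMap.ext h)

lemma isIso_of_bijective {M N : RMod Λ} (f : M ⟶ N) (hf : Function.Bijective f.hom.hom) :
    IsIso f := by
  have : f = (LinearEquiv.toFGModuleCatIso (LinearEquiv.ofBijective f.hom.hom hf)).hom :=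
    FGModuleCat.hom_ext rfl
  rw [this]
  infer_instance

/-- The unit at Λ identifies F(Λ) with Hom(Λ, ϑF), and evaluation at 1 detects whether ϑF is zero.
-/
lemma mod₀_eq_kernel (hΛ : 𝒳 (regular Λ)) : mod₀ hΛ = (theta 𝒳).kernel := by
  funext F
  have hb := thetaUnit_bijective F (Y := ⟨regular Λ, hΛ⟩) (prj_regular Λ)
  refine propext ⟨fun h => isZero_iff.2 fun x => ?_, fun h => ?_⟩
  · have : Subsingleton (F.obj.obj (op ⟨regular Λ, hΛ⟩)) := AddCommGrpCat.subsingleton_of_isZero h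
    obtain ⟨z, hz⟩ := hb.2 (ofElement x)
    obtain ⟨z', hz'⟩ := hb.2 0
    have e : (ofElement x : regular Λ ⟶ (theta 𝒳).obj F) = 0 := by
      rw [← hz, ← hz', Subsingleton.elim z z']
    rw [← ofElement_one x, e]
    rfl
  · have : Subsingleton (F.obj.obj (op ⟨regular Λ, hΛ⟩)) :=
      ⟨fun a b => hb.1 (Limits.IsZero.eq_of_tgt h _ _)⟩
    exact AddCommGrpCat.isZero_of_subsingleton _

lemma thetaUnit_comp_counit (hFP : ∀ M, IsFP 𝒳 (homX 𝒳 M)) (M : RMod Λ)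
    {Y : 𝒳.FullSubcategory} (z : Y.obj ⟶ M) :
    thetaUnit ((thetaRho hFP).obj M) (Y := Y) z ≫ (thetaAdjRho hFP).counit.app M = z := by
  have h : toThetaRho hFP ((thetaAdjRho hFP).counit.app M) = 𝟙 _ := by
    have e : (thetaAdjRho hFP).counit.app M = (Equiv.ofBijective _
        (toThetaRho_bijective hFP ((thetaRho hFP).obj M) M)).symm (𝟙 _) := by
      simp [thetaAdjRho]
    rw [e]
    exact (Equiv.ofBijective _ (toThetaRho_bijective hFP _ M)).apply_symm_apply _
  have h1 := toThetaRho_app hFP ((thetaAdjRho hFP).counit.app M) (Y := Y) z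
  rw [h] at h1
  exact h1.symm

/-- At Λ the unit is bijective, and unit followed by counit is the identity on Hom(Λ, M); reading
elements as maps from Λ, the counit is bijective. -/
instance thetaAdjRho_counit_isIso (hFP : ∀ M, IsFP 𝒳 (homX 𝒳 M)) [hΛ : Fact (𝒳 (regular Λ))] :
    IsIso (thetaAdjRho hFP).counit := by
  have key : ∀ M, IsIso ((thetaAdjRho hFP).counit.app M) := by
    intro M
    have hb := thetaUnit_bijective ((thetaRho hFP).obj M) (Y := ⟨regular Λ, hΛ.out⟩)
      (prj_regular Λ)
    have hu := thetaUnit_comp_counit hFP M (Y := ⟨regular Λ, hΛ.out⟩)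
    refine isIso_of_bijective _ ⟨?_, fun y => ?_⟩
    · refine (injective_iff_map_eq_zero _).2 fun x hx => ?_
      obtain ⟨z, hz⟩ := hb.2 (ofElement x)
      have hz0 : z = (0 : regular Λ ⟶ M) := by
        refine (hu z).symm.trans ?_
        rw [hz]
        refine regular_hom_ext ?_
        refine (congrArg ((thetaAdjRho hFP).counit.app M).hom.hom (ofElement_one x)).trans hx
      have e : (ofElement x : regular Λ ⟶ (theta 𝒳).obj ((thetaRho hFP).obj M)) = 0 := by
        rw [← hz, hz0]
        exact thetaUnit_zero ((thetaRho hFP).obj M) ⟨regular Λ, hΛ.out⟩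
      rw [← ofElement_one x, e]
      rfl
    · refine ⟨(thetaUnit ((thetaRho hFP).obj M) (Y := ⟨regular Λ, hΛ.out⟩)
        (ofElement y)).hom.hom (1 : Λ), ?_⟩
      exact (hom_apply_eq (hu (ofElement y)) (1 : Λ)).trans (ofElement_one y)
  exact NatIso.isIso_of_isIso_app _

lemma exists_prj_presentation [IsArtinAlgebra Λ] (M : RMod Λ) :
    ∃ (P₁ P₀ : RMod Λ) (d : P₁ ⟶ P₀) (p : P₀ ⟶ M), prj Λ P₁ ∧ prj Λ P₀ ∧
      Function.Surjective p.hom.hom ∧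
      ∀ x, p.hom.hom x = 0 ↔ x ∈ LinearMap.range d.hom.hom := by
  obtain ⟨n, p, hp⟩ := exists_free_surjective M
  let K : RMod Λ := FGModuleCat.of Λᵐᵒᵖ (LinearMap.ker p.hom.hom)
  obtain ⟨m, q, hq⟩ := exists_free_surjective K
  refine ⟨_, _, q ≫ FGModuleCat.ofHom (LinearMap.ker p.hom.hom).subtype, p, prj_free m, prj_free n,
    hp, fun x => ⟨fun hx => ?_, ?_⟩⟩
  · obtain ⟨y, hy⟩ := hq ⟨x, hx⟩
    exact ⟨y, congrArg Subtype.val hy⟩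
  · rintro ⟨y, rfl⟩
    exact LinearMap.mem_ker.1 (q.hom.hom y).2

/-- The left adjoint sends M, with projective presentation P₁ → P₀, to the cokernel of Hom(-, P₁) →
Hom(-, P₀). Maps from it to F form the kernel of F(P₀) → F(P₁); the unit is bijective on
projectives, so this is the kernel of Hom(P₀, ϑF) → Hom(P₁, ϑF), which is Hom(M, ϑF). -/
lemma theta_isRightAdjoint [IsArtinAlgebra Λ] (hprj : prj Λ ≤ 𝒳) :
    (theta 𝒳).IsRightAdjoint := by
  choose P₁ P₀ d p hP₁ hP₀ hp hd using exists_prj_presentation (Λ := Λ)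
  let L : RMod Λ → ModX 𝒳 := fun M =>
    ⟨_, isFP_cokFunctor (𝒳 := 𝒳) (Y₁ := ⟨P₁ M, hprj _ (hP₁ M)⟩) (Y₀ := ⟨P₀ M, hprj _ (hP₀ M)⟩)
      (d M)⟩
  let P : ∀ M, Presentation (L M).obj := fun M =>
    { X₁ := ⟨P₁ M, hprj _ (hP₁ M)⟩
      X₀ := ⟨P₀ M, hprj _ (hP₀ M)⟩
      d := d M
      π := { app := fun Z => AddCommGrpCat.ofHom (QuotientAddGroup.mk' (cokRel (d M) Z.unop.obj)) }
      surj := fun Z => QuotientAddGroup.mk_surjective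
      exact := fun Z f => QuotientAddGroup.eq_zero_iff (N := cokRel (d M) Z.obj) f }
  let z : ∀ {M F}, (L M ⟶ F) → F.obj.obj (op (P M).X₀) := fun {M F} τ =>
    τ.hom.app (op (P M).X₀) ((P M).π.app (op (P M).X₀) (𝟙 (P M).X₀.obj))
  have hz : ∀ {M F} (τ : L M ⟶ F), d M ≫ thetaUnit F (z τ) = 0 := by
    intro M F τ
    have h := (P M).map_d_app τ.hom
    have h2 := thetaUnit_map F (ObjectProperty.homMk (P M).d : (P M).X₁ ⟶ (P M).X₀) (z τ)
    refine h2.symm.trans ?_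
    exact (congrArg (thetaUnit F) h).trans (thetaUnit_zero F (P M).X₁)
  have hex : ∀ {M F} (τ : L M ⟶ F), ∃ g : M ⟶ (theta 𝒳).obj F, p M ≫ g = thetaUnit F (z τ) := by
    intro M F τ
    refine exists_desc (hp M) _ fun x hx => ?_
    obtain ⟨y, rfl⟩ := (hd M x).1 hx
    exact hom_apply_eq (hz τ) y
  choose e he using @hex
  have hb : ∀ M F, Function.Bijective (e (M := M) (F := F)) := by
    intro M F
    have hbij := thetaUnit_bijective F (Y := (P M).X₀) (hP₀ M)
    have hbij₁ := thetaUnit_bijective F (Y := (P M).X₁) (hP₁ M)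
    refine ⟨fun σ τ h => ?_, fun g => ?_⟩
    · refine ObjectProperty.hom_ext _ ((P M).hom_ext ?_)
      refine hbij.1 ((he σ).symm.trans (Eq.trans ?_ (he τ)))
      rw [h]
    · obtain ⟨w, hw⟩ := hbij.2 (p M ≫ g)
      have hw0 : F.obj.map (ObjectProperty.homMk (P M).d : (P M).X₁ ⟶ (P M).X₀).op w = 0 := by
        refine hbij₁.1 ?_
        rw [thetaUnit_map, hw]
        refine Eq.trans ?_ (thetaUnit_zero F (P M).X₁).symm
        refine FGModuleCat.hom_ext (LinearMap.ext fun y => ?_)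
        exact (congrArg g.hom.hom ((hd M _).2 ⟨y, rfl⟩)).trans (map_zero _)
      obtain ⟨τ, hτ⟩ := (P M).exists_hom w hw0
      refine ⟨ObjectProperty.homMk τ, comp_cancel_of_surjective (hp M) ?_⟩
      rw [he]
      exact (congrArg (thetaUnit F) hτ).trans hw
  exact ⟨_, ⟨Adjunction.adjunctionOfEquivLeft (G := theta 𝒳)
    (fun M F => Equiv.ofBijective _ (hb M F)) fun M F F' τ σ => by
      refine comp_cancel_of_surjective (hp M) ?_
      refine (he (σ ≫ τ)).trans ?_
      refine (thetaUnit_app τ (z σ)).trans ?_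
      refine (congrArg (· ≫ (theta 𝒳).map τ) (he σ).symm).trans ?_
      exact Category.assoc _ _ _⟩⟩

theorem nonempty_recollementX [IsArtinAlgebra Λ] (hcf : ContravariantlyFinite 𝒳)
    (hprj : prj Λ ≤ 𝒳) (hsub : 𝒳.IsClosedUnderSubobjects) {X : 𝒳.FullSubcategory}
    (hX : IsAddGenerator 𝒳 X) : Nonempty (RecollementX (hprj _ (prj_regular Λ))) := by
  have hFP := isFP_homX_of_contravariantlyFinite hcf hsub
  have : Fact (𝒳 (regular Λ)) := ⟨hprj _ (prj_regular Λ)⟩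
  have := theta_isRightAdjoint hprj
  have := theta_additive hFP
  have : Limits.HasFiniteProducts (ModX 𝒳) :=
    ⟨fun _ => Adjunction.hasLimitsOfShape_of_equivalence (evalX hX)⟩
  let _ : Abelian (ModX 𝒳) := abelianOfEquivalence (evalX hX)
  have hff := (thetaAdjRho hFP).fullyFaithfulROfIsIsoCounit
  have := hff.full
  have := hff.faithful
  rw [RecollementX, mod₀_eq_kernel]
  exact nonempty_recollement_of_adjoints (Adjunction.ofIsRightAdjoint (theta 𝒳)) (thetaAdjRho hFP)

/-- Both adjunctions of ϑ are carried along the equivalence e, after which the generic construction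
applies to μ. -/
theorem nonempty_recollementΓ [IsArtinAlgebra Λ] (hcf : ContravariantlyFinite 𝒳)
    (hprj : prj Λ ≤ 𝒳) (hsub : 𝒳.IsClosedUnderSubobjects) {X : 𝒳.FullSubcategory}
    (hX : IsAddGenerator 𝒳 X) : Nonempty (RecollementΓ hX) := by
  have hFP := isFP_homX_of_contravariantlyFinite hcf hsub
  have : Fact (𝒳 (regular Λ)) := ⟨hprj _ (prj_regular Λ)⟩
  have := theta_isRightAdjoint hprj
  have hff := (thetaAdjRho hFP).fullyFaithfulROfIsIsoCounit
  have := hff.full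
  have := hff.faithful
  have adjrho : mu hX ⊣ thetaRho hFP ⋙ evalX hX :=
    (evalX hX).asEquivalence.symm.toAdjunction.comp (thetaAdjRho hFP)
  have adjlam : (theta 𝒳).leftAdjoint ⋙ evalX hX ⊣ mu hX :=
    (Adjunction.ofIsRightAdjoint (theta 𝒳)).comp (evalX hX).asEquivalence.toAdjunction
  have : (evalX hX).Additive := ⟨rfl⟩
  have : (thetaRho hFP ⋙ evalX hX).Additive := inferInstance
  have : (mu hX).Additive := adjrho.left_adjoint_additive
  exact nonempty_recollement_of_adjoints adjlam adjrho

end Existence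

/-! ### Ker L_λ and Ker L_ρ as Hom-orthogonals. -/

section RecollementKernels

variable {A' : Type u₁} {A : Type u₂} {A'' : Type u₃} [Category.{v₁} A'] [Category.{v₂} A]
  [Category.{v₃} A''] [Preadditive A'] [Preadditive A] [Preadditive A'']
  {ℓ : A' ⥤ A} {ϑ : A ⥤ A''}

lemma Recollement.ℓrho_kernel_iff (R : Recollement ℓ ϑ) (F : A) :
    R.ℓrho.kernel F ↔ ∀ (G : A') (f : ℓ.obj G ⟶ F), f = 0 := by
  refine ⟨fun h G f => (R.adjℓrho.homEquiv _ _).injective (Limits.IsZero.eq_of_tgt h _ _),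
    fun h => ?_⟩
  refine (Limits.IsZero.iff_id_eq_zero _).2 ((R.adjℓrho.homEquiv _ _).symm.injective ?_)
  rw [h _ ((R.adjℓrho.homEquiv _ _).symm (𝟙 _)), h _ ((R.adjℓrho.homEquiv _ _).symm 0)]

lemma Recollement.ℓlam_kernel_iff (R : Recollement ℓ ϑ) (F : A) :
    R.ℓlam.kernel F ↔ ∀ (G : A') (f : F ⟶ ℓ.obj G), f = 0 := by
  refine ⟨fun h G f => (R.adjℓlam.homEquiv _ _).symm.injective (Limits.IsZero.eq_of_src h _ _),
    fun h => ?_⟩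
  refine (Limits.IsZero.iff_id_eq_zero _).2 ((R.adjℓlam.homEquiv _ _).injective ?_)
  rw [h _ ((R.adjℓlam.homEquiv _ _) (𝟙 _)), h _ ((R.adjℓlam.homEquiv _ _) 0)]

end RecollementKernels

/-! ### The Γ-modules Hom(X, M) and the kernel of μ. -/

section HomMod

variable {Λ : Type u} [Ring Λ] {𝒳 : ObjectProperty (RMod Λ)}

/-- The right `End(X)`-module `Hom(X, M)`. -/
abbrev HomMod (X : 𝒳.FullSubcategory) (M : RMod Λ) : Type u := EvalMod (homX 𝒳 M) X

namespace HomMod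

variable {X : 𝒳.FullSubcategory}

/-- A morphism `X ⟶ M` as an element of the module `Hom(X, M)`. -/
def mk {M : RMod Λ} (f : X.obj ⟶ M) : HomMod X M := f

/-- The morphism `X ⟶ M` underlying an element of `Hom(X, M)`. -/
def hom {M : RMod Λ} (f : HomMod X M) : X.obj ⟶ M := f

@[simp] lemma hom_mk {M : RMod Λ} (f : X.obj ⟶ M) : (mk f).hom = f := rfl

lemma hom_add {M : RMod Λ} (f g : HomMod X M) : (f + g).hom = f.hom + g.hom := rfl

lemma ext {M : RMod Λ} {f g : HomMod X M} (h : f.hom = g.hom) : f = g := h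

lemma hom_sum {M : RMod Λ} {ι : Type*} (s : Finset ι) (f : ι → HomMod X M) :
    (∑ i ∈ s, f i).hom = ∑ i ∈ s, (f i).hom :=
  map_sum (AddMonoidHom.mk' (hom (X := X) (M := M)) hom_add) f s

/-- Postcomposition with a morphism. -/
def map {M N : RMod Λ} (f : M ⟶ N) : HomMod X M →ₗ[(Aus X.obj)ᵐᵒᵖ] HomMod X N where
  toFun g := mk (g.hom ≫ f)
  map_add' g h := Preadditive.add_comp _ _ _ g.hom h.hom f
  map_smul' _ g := Category.assoc _ g.hom f

lemma map_hom {M N : RMod Λ} (f : M ⟶ N) (g : HomMod X M) : (map f g).hom = g.hom ≫ f := rfl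

lemma map_comp {L M N : RMod Λ} (f : L ⟶ M) (g : M ⟶ N) :
    map (X := X) (f ≫ g) = map g ∘ₗ map f :=
  LinearMap.ext fun h => (Category.assoc h.hom f g).symm

lemma map_injective {M N : RMod Λ} {f : M ⟶ N} (hf : Function.Injective f.hom.hom) :
    Function.Injective (map (X := X) f) := by
  have := mono_of_injective f hf
  exact fun g h e => (cancel_mono f).1 (congrArg hom e : g.hom ≫ f = h.hom ≫ f)

variable (hX : IsAddGenerator 𝒳 X)
include hX

lemma exists_sum_retract {Y : RMod Λ} (hY : 𝒳 Y) :
    ∃ (n : ℕ) (s : Fin n → (Y ⟶ X.obj)) (r : Fin n → (X.obj ⟶ Y)), ∑ i, s i ≫ r i = 𝟙 Y := by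
  obtain ⟨n, s, r, e⟩ := hX.exists_retract ⟨Y, hY⟩
  refine ⟨n, fun i => (s i).hom, fun i => (r i).hom, ?_⟩
  have := congrArg (fun q : (⟨Y, hY⟩ : 𝒳.FullSubcategory) ⟶ ⟨Y, hY⟩ => q.hom) e
  refine Eq.trans ?_ this
  exact (map_sum (𝒳.ι.mapAddHom (X := ⟨Y, hY⟩) (Y := ⟨Y, hY⟩)) _ _).symm

/-- A morphism out of an object of `𝒳` is determined by its action on morphisms from `X`. -/
lemma hom_ext_of_generator {Y : RMod Λ} (hY : 𝒳 Y) {M : RMod Λ} {f g : Y ⟶ M}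
    (h : ∀ r : X.obj ⟶ Y, r ≫ f = r ≫ g) : f = g := by
  obtain ⟨n, s, r, e⟩ := exists_sum_retract hX hY
  rw [← Category.id_comp f, ← Category.id_comp g, ← e, Preadditive.sum_comp,
    Preadditive.sum_comp]
  refine Finset.sum_congr rfl fun i _ => ?_
  rw [Category.assoc, Category.assoc, h]

lemma map_ext {Y : RMod Λ} (hY : 𝒳 Y) {M : RMod Λ} {f g : Y ⟶ M}
    (h : map (X := X) f = map g) : f = g :=
  hom_ext_of_generator hX hY fun r => congrArg hom (LinearMap.congr_fun h (mk r))

/-- Evaluation at X is full, and by Yoneda a transformation out of Hom(-, Y) is composition with the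
image of the identity of Y. -/
lemma exists_map_eq {Y : RMod Λ} (hY : 𝒳 Y) {M : RMod Λ}
    (φ : HomMod X Y →ₗ[(Aus X.obj)ᵐᵒᵖ] HomMod X M) : ∃ f : Y ⟶ M, map f = φ := by
  obtain ⟨τ, hτ⟩ := exists_evalMap_eq hX φ
  refine ⟨τ.app (op ⟨Y, hY⟩) (𝟙 Y), LinearMap.ext fun g => ?_⟩
  have h1 := ConcreteCategory.congr_hom
    (τ.naturality (ObjectProperty.homMk g.hom : X ⟶ ⟨Y, hY⟩).op) (𝟙 Y)
  have h2 : (homX 𝒳 Y).map (ObjectProperty.homMk g.hom : X ⟶ ⟨Y, hY⟩).op (𝟙 Y) = g.hom :=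
    Category.comp_id g.hom
  have h3 : τ.app (op X) g.hom = g.hom ≫ τ.app (op ⟨Y, hY⟩) (𝟙 Y) :=
    (congrArg (τ.app (op X)) h2.symm).trans h1
  exact h3.symm.trans (LinearMap.congr_fun hτ g)

lemma finite {Y : RMod Λ} (hY : 𝒳 Y) : Module.Finite (Aus X.obj)ᵐᵒᵖ (HomMod X Y) :=
  finite_evalMod hX ⟨_, isFP_homX ⟨Y, hY⟩⟩

/-- Y is a summand of X^n, so Hom(X, Y) is a summand of Γ^n. -/
lemma projective {Y : RMod Λ} (hY : 𝒳 Y) : Module.Projective (Aus X.obj)ᵐᵒᵖ (HomMod X Y) := by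
  obtain ⟨n, s, r, h⟩ := exists_sum_retract hX hY
  let i : HomMod X Y →ₗ[(Aus X.obj)ᵐᵒᵖ] (Fin n → (Aus X.obj)ᵐᵒᵖ) :=
    LinearMap.pi fun j =>
      { toFun := fun g => MulOpposite.op (g.hom ≫ s j).hom.hom
        map_add' := fun g g' => by rw [hom_add, Preadditive.add_comp]; rfl
        map_smul' := fun a g => rfl }
  let p : (Fin n → (Aus X.obj)ᵐᵒᵖ) →ₗ[(Aus X.obj)ᵐᵒᵖ] HomMod X Y :=
    ∑ j, (LinearMap.toSpanSingleton (Aus X.obj)ᵐᵒᵖ (HomMod X Y) (mk (r j))) ∘ₗ LinearMap.proj j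
  refine Module.Projective.of_split i p (LinearMap.ext fun g => ext ?_)
  have e : p (i g) = ∑ j, mk ((g.hom ≫ s j) ≫ r j) := LinearMap.sum_apply _ _ _
  change (p (i g)).hom = g.hom
  rw [e, hom_sum]
  simp only [hom_mk, Category.assoc]
  rw [← Preadditive.comp_sum, h, Category.comp_id]

/-- Every finitely generated module is a quotient of some `Hom(X, Y)` with `Y ∈ 𝒳`. -/
lemma exists_surjective (N : Type u) [AddCommGroup N] [Module (Aus X.obj)ᵐᵒᵖ N]
    [Module.Finite (Aus X.obj)ᵐᵒᵖ N] :
    ∃ (Y : RMod Λ) (_ : 𝒳 Y) (p : HomMod X Y →ₗ[(Aus X.obj)ᵐᵒᵖ] N), Function.Surjective p := by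
  obtain ⟨Y, p, hp⟩ := RelAus.exists_surjective hX N
  exact ⟨Y.obj, Y.property, p, hp⟩

/-- Yoneda on the module side: maps Hom(X, Y) → F(X) correspond to elements of F(Y). -/
lemma forall_eq_zero_iff {Y : 𝒳.FullSubcategory} (F : 𝒳.FullSubcategoryᵒᵖ ⥤ AddCommGrpCat.{u})
    [F.Additive] : (∀ φ : HomMod X Y.obj →ₗ[(Aus X.obj)ᵐᵒᵖ] EvalMod F X, φ = 0) ↔
      ∀ z : F.obj (op Y), z = 0 := by
  constructor
  · intro h z
    let φ : HomMod X Y.obj →ₗ[(Aus X.obj)ᵐᵒᵖ] EvalMod F X :=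
      { toFun := fun g => actHom F z X (ObjectProperty.homMk g.hom)
        map_add' := fun g g' =>
          map_add (actHom F z X) (ObjectProperty.homMk g.hom) (ObjectProperty.homMk g'.hom)
        map_smul' := fun a g =>
          map_comp_apply' F (toEnd a.unop) (ObjectProperty.homMk g.hom : X ⟶ Y) z }
    refine eq_of_forall_map F hX fun q => ?_
    rw [map_zero]
    exact LinearMap.congr_fun (h φ) (mk q.hom)
  · intro h φ
    obtain ⟨τ, rfl⟩ := exists_evalMap_eq hX φ
    refine LinearMap.ext fun (g : HomMod X Y.obj) => ?_
    have h1 := ConcreteCategory.congr_hom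
      (τ.naturality (ObjectProperty.homMk g.hom : X ⟶ Y).op) (𝟙 Y.obj)
    have h2 : (homX 𝒳 Y.obj).map (ObjectProperty.homMk g.hom : X ⟶ Y).op (𝟙 Y.obj) = g.hom :=
      Category.comp_id g.hom
    refine ((congrArg (τ.app (op X)) h2.symm).trans h1).trans ?_
    refine (congrArg (F.map (ObjectProperty.homMk g.hom : X ⟶ Y).op)
      (h (τ.app (op Y) (𝟙 Y.obj)))).trans ?_
    exact map_zero (F.map _).hom

end HomMod

/-- The modules without nonzero maps from `Hom(X, Λ)`; these form the kernel of `μ`. -/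
def VanishesAtRegular (X : 𝒳.FullSubcategory) (N : Type u) [AddCommGroup N]
    [Module (Aus X.obj)ᵐᵒᵖ N] : Prop :=
  ∀ φ : HomMod X (regular Λ) →ₗ[(Aus X.obj)ᵐᵒᵖ] N, φ = 0

variable {X : 𝒳.FullSubcategory}

lemma VanishesAtRegular.of_equiv {N N' : Type u} [AddCommGroup N] [Module (Aus X.obj)ᵐᵒᵖ N]
    [AddCommGroup N'] [Module (Aus X.obj)ᵐᵒᵖ N'] (h : VanishesAtRegular X N)
    (e : N ≃ₗ[(Aus X.obj)ᵐᵒᵖ] N') : VanishesAtRegular X N' := fun φ => by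
  have := h (e.symm.toLinearMap ∘ₗ φ)
  refine LinearMap.ext fun x => e.symm.injective ?_
  exact (LinearMap.congr_fun this x).trans (map_zero _).symm

lemma theta_kernel_iff (hX : IsAddGenerator 𝒳 X) (hΛ : 𝒳 (regular Λ)) (F : ModX 𝒳) :
    (theta 𝒳).kernel F ↔ VanishesAtRegular X ((evalX hX).obj F) := by
  rw [← mod₀_eq_kernel hΛ]
  refine Iff.trans ?_ (HomMod.forall_eq_zero_iff hX (Y := ⟨regular Λ, hΛ⟩) F.obj).symm
  constructor
  · intro h z
    have := AddCommGrpCat.subsingleton_of_isZero h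
    exact Subsingleton.elim _ _
  · intro h
    have : Subsingleton (F.obj.obj (op ⟨regular Λ, hΛ⟩)) :=
      ⟨fun a b => (h a).trans (h b).symm⟩
    exact AddCommGrpCat.isZero_of_subsingleton _

lemma mu_kernel_iff [IsArtinAlgebra Λ] (hX : IsAddGenerator 𝒳 X) (hΛ : 𝒳 (regular Λ))
    (N : RMod (Aus X.obj)) : (mu hX).kernel N ↔ VanishesAtRegular X N := by
  refine (theta_kernel_iff hX hΛ ((evalX hX).inv.obj N)).trans ?_
  let i := FGModuleCat.isoToLinearEquiv ((evalX hX).asEquivalence.counitIso.app N)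
  exact ⟨fun h => h.of_equiv i, fun h => h.of_equiv i.symm⟩

lemma ℓrho_kernel_iff [IsArtinAlgebra Λ] (hX : IsAddGenerator 𝒳 X) (hΛ : 𝒳 (regular Λ))
    (S : RecollementΓ hX) (N : RMod (Aus X.obj)) : S.ℓrho.kernel N ↔
      ∀ G : RMod (Aus X.obj), VanishesAtRegular X G →
        ∀ φ : G →ₗ[(Aus X.obj)ᵐᵒᵖ] N, φ = 0 := by
  rw [S.ℓrho_kernel_iff]
  constructor
  · intro h G hG φ
    have := h ⟨G, (mu_kernel_iff hX hΛ G).2 hG⟩ (ObjectProperty.homMk (ModuleCat.ofHom φ))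
    exact congrArg (fun q : G ⟶ N => q.hom.hom) this
  · intro h G f
    exact FGModuleCat.hom_ext (h G.obj ((mu_kernel_iff hX hΛ _).1 G.property) f.hom.hom)

lemma ℓlam_kernel_iff [IsArtinAlgebra Λ] (hX : IsAddGenerator 𝒳 X) (hΛ : 𝒳 (regular Λ))
    (S : RecollementΓ hX) (N : RMod (Aus X.obj)) : S.ℓlam.kernel N ↔
      ∀ G : RMod (Aus X.obj), VanishesAtRegular X G →
        ∀ φ : N →ₗ[(Aus X.obj)ᵐᵒᵖ] G, φ = 0 := by
  rw [S.ℓlam_kernel_iff]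
  constructor
  · intro h G hG φ
    have := h ⟨G, (mu_kernel_iff hX hΛ G).2 hG⟩ (ObjectProperty.homMk (ModuleCat.ofHom φ))
    exact congrArg (fun q : N ⟶ G => q.hom.hom) this
  · intro h G f
    exact FGModuleCat.hom_ext (h G.obj ((mu_kernel_iff hX hΛ _).1 G.property) f.hom.hom)

end HomMod

/-! ### The map γ under ϑ. -/

section Gamma

variable {A' : Type u₁} {A : Type u₂} {A'' : Type u₃} [Category.{v₁} A'] [Category.{v₂} A]
  [Category.{v₃} A''] [Preadditive A'] [Preadditive A] [Preadditive A'']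
  {ℓ : A' ⥤ A} {ϑ : A ⥤ A''}

/-- By the definition of γ, the unit at M followed by ϑ(γ) is the inverse counit; the unit is
invertible because ϑ_λ is fully faithful. -/
lemma Recollement.isIso_map_γ (R : Recollement ℓ ϑ) (M : A'') : IsIso (ϑ.map (R.γ M)) := by
  have := R.full_ϑlam
  have := R.faithful_ϑlam
  have h : R.adjϑlam.unit.app M ≫ ϑ.map (R.γ M) = inv (R.adjϑrho.counit.app M) := by
    exact (R.adjϑlam.homEquiv_unit _ _ _).symm.trans
      ((R.adjϑlam.homEquiv _ _).apply_symm_apply _)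
  have : IsIso (R.adjϑlam.unit.app M ≫ ϑ.map (R.γ M)) := h ▸ inferInstance
  exact IsIso.of_isIso_comp_left (R.adjϑlam.unit.app M) _

lemma Recollement.hom_ϑlam_eq_zero (R : Recollement ℓ ϑ) {M : A''} {G : A} (hG : ϑ.kernel G)
    (f : R.ϑlam.obj M ⟶ G) : f = 0 :=
  (R.adjϑlam.homEquiv _ _).injective (Limits.IsZero.eq_of_tgt hG _ _)

/-- ϑ(γ) is invertible, so ϑ(q) = 0; ϑ preserves epimorphisms, so ϑ kills the target of q. -/
lemma Recollement.kernel_of_γ_comp_eq_zero (R : Recollement ℓ ϑ) {M : A''} {G : A}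
    (q : R.ϑrho.obj M ⟶ G) [Epi q] (h : R.γ M ≫ q = 0) : ϑ.kernel G := by
  have := R.isIso_map_γ M
  have := R.additive_ϑ
  have : ϑ.IsLeftAdjoint := ⟨_, ⟨R.adjϑrho⟩⟩
  have h0 : ϑ.map q = 0 := by
    rw [← cancel_epi (ϑ.map (R.γ M)), ← ϑ.map_comp, h, ϑ.map_zero, Limits.comp_zero]
  exact Limits.IsZero.of_epi_eq_zero _ h0

end Gamma

/-- The noetherian hypothesis keeps the module-theoretic kernel finitely generated, so it is
available as a test object. -/
lemma injective_of_mono {Λ : Type u} [Ring Λ] [IsNoetherianRing Λᵐᵒᵖ] {M N : RMod Λ} (f : M ⟶ N)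
    [Mono f] : Function.Injective f.hom.hom := by
  refine (injective_iff_map_eq_zero _).2 fun x hx => ?_
  let K : RMod Λ := FGModuleCat.of Λᵐᵒᵖ (LinearMap.ker f.hom.hom)
  let i : K ⟶ M := FGModuleCat.ofHom (LinearMap.ker f.hom.hom).subtype
  have hi : i = 0 := by
    rw [← cancel_mono f, Limits.zero_comp]
    exact FGModuleCat.hom_ext (LinearMap.ext fun y => LinearMap.mem_ker.1 y.2)
  exact hom_apply_eq hi ⟨x, hx⟩

lemma epi_of_surjective {Λ : Type u} [Ring Λ] {M N : RMod Λ} (f : M ⟶ N)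
    (hf : Function.Surjective f.hom.hom) : Epi f where
  left_cancellation _ _ e := comp_cancel_of_surjective hf e

/-! ### T as the trace of Hom(X, Λ) in Hom(X, X). -/

section Trace

variable {Λ : Type u} [Ring Λ] {𝒳 : ObjectProperty (RMod Λ)} {X : 𝒳.FullSubcategory}

/-- The trace of `Hom(X, Λ)` in a module. -/
def regularTrace (X : 𝒳.FullSubcategory) (N : Type u) [AddCommGroup N]
    [Module (Aus X.obj)ᵐᵒᵖ N] : Submodule (Aus X.obj)ᵐᵒᵖ N :=
  ⨆ φ : HomMod X (regular Λ) →ₗ[(Aus X.obj)ᵐᵒᵖ] N, LinearMap.range φ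

lemma apply_mem_regularTrace {N : Type u} [AddCommGroup N] [Module (Aus X.obj)ᵐᵒᵖ N]
    (φ : HomMod X (regular Λ) →ₗ[(Aus X.obj)ᵐᵒᵖ] N) (x) : φ x ∈ regularTrace X N :=
  le_iSup (fun φ : HomMod X (regular Λ) →ₗ[(Aus X.obj)ᵐᵒᵖ] N => LinearMap.range φ) φ ⟨x, rfl⟩

/-- Hom(X, Λ) is projective, so a map to the quotient lifts to N, where it lands in the trace. -/
lemma vanishesAtRegular_quotient_regularTrace (hX : IsAddGenerator 𝒳 X) (hΛ : 𝒳 (regular Λ))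
    (N : Type u) [AddCommGroup N] [Module (Aus X.obj)ᵐᵒᵖ N] :
    VanishesAtRegular X (N ⧸ regularTrace X N) := by
  intro φ
  have := HomMod.projective hX hΛ
  obtain ⟨ψ, rfl⟩ := Module.projective_lifting_property (regularTrace X N).mkQ φ
    (Submodule.mkQ_surjective _)
  exact LinearMap.ext fun x => (Submodule.Quotient.mk_eq_zero _).2 (apply_mem_regularTrace ψ x)

/-- Makes the trace the smallest submodule whose quotient is in Ker μ. -/
lemma regularTrace_le_of_vanishesAtRegular {N : Type u} [AddCommGroup N]
    [Module (Aus X.obj)ᵐᵒᵖ N] {S : Submodule (Aus X.obj)ᵐᵒᵖ N} (h : VanishesAtRegular X (N ⧸ S)) :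
    regularTrace X N ≤ S := by
  refine iSup_le fun φ => ?_
  rintro _ ⟨x, rfl⟩
  exact (Submodule.Quotient.mk_eq_zero _).1 (LinearMap.congr_fun (h (S.mkQ ∘ₗ φ)) x)

lemma map_regularTrace_le {N N' : Type u} [AddCommGroup N] [Module (Aus X.obj)ᵐᵒᵖ N]
    [AddCommGroup N'] [Module (Aus X.obj)ᵐᵒᵖ N'] (f : N →ₗ[(Aus X.obj)ᵐᵒᵖ] N') :
    (regularTrace X N).map f ≤ regularTrace X N' := by
  rw [regularTrace, Submodule.map_iSup]
  refine iSup_le fun φ => ?_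
  rintro _ ⟨_, ⟨x, rfl⟩, rfl⟩
  exact apply_mem_regularTrace (f ∘ₗ φ) x

/-- The counit isomorphism of the evaluation equivalence. -/
def evalCounitIso [IsArtinAlgebra Λ] (hX : IsAddGenerator 𝒳 X) (G : RMod (Aus X.obj)) :
    (evalX hX).obj ((evalX hX).inv.obj G) ≅ G :=
  (evalX hX).asEquivalence.counitIso.app G

lemma hom_eq_zero_of_ϑlam [IsArtinAlgebra Λ] (hX : IsAddGenerator 𝒳 X) {hΛ : 𝒳 (regular Λ)}
    (R : RecollementX hΛ) {M : RMod Λ} {G : RMod (Aus X.obj)} (hG : VanishesAtRegular X G)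
    (f : (evalX hX).obj (R.ϑlam.obj M) ⟶ G) : f = 0 := by
  let i := evalCounitIso hX G
  have hG' : (theta 𝒳).kernel ((evalX hX).inv.obj G) :=
    (theta_kernel_iff hX hΛ _).2 (hG.of_equiv (FGModuleCat.isoToLinearEquiv i).symm)
  obtain ⟨f', hf'⟩ := (evalX hX).map_surjective (f ≫ i.inv)
  rw [R.hom_ϑlam_eq_zero hG' f'] at hf'
  rw [← cancel_mono i.inv, Limits.zero_comp]
  exact hf'.symm

/-- `T = ζ_X(X)` embeds into `Hom(X, X)`, with image the trace of `Hom(X, Λ)`. -/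
theorem exists_zetaXX_embedding [IsArtinAlgebra Λ] (hcf : ContravariantlyFinite 𝒳)
    (hsub : 𝒳.IsClosedUnderSubobjects) (hX : IsAddGenerator 𝒳 X) {hΛ : 𝒳 (regular Λ)}
    (R : RecollementX hΛ) :
    ∃ j : zetaXX hX R →ₗ[(Aus X.obj)ᵐᵒᵖ] HomMod X X.obj, Function.Injective j ∧
      LinearMap.range j = regularTrace X (HomMod X X.obj) := by
  have hFP := isFP_homX_of_contravariantlyFinite hcf hsub
  have : Limits.HasFiniteProducts (ModX 𝒳) :=
    ⟨fun _ => Adjunction.hasLimitsOfShape_of_equivalence (evalX hX)⟩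
  let _ : Abelian (ModX 𝒳) := abelianOfEquivalence (evalX hX)
  -- Uniqueness of right adjoints identifies ϑ_ρ(X) with Hom(-, X) for an arbitrary recollement R.
  let i : R.ϑrho.obj X.obj ≅ (thetaRho hFP).obj X.obj :=
    (R.adjϑrho.rightAdjointUniq (thetaAdjRho hFP)).app X.obj
  have : Module.Finite (Aus X.obj)ᵐᵒᵖ (HomMod X X.obj) := HomMod.finite hX X.property
  let H : RMod (Aus X.obj) := FGModuleCat.of (Aus X.obj)ᵐᵒᵖ (HomMod X X.obj)
  let i' : (evalX hX).obj (R.ϑrho.obj X.obj) ≅ H := (evalX hX).mapIso i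
  let Z : RMod (Aus X.obj) := (evalX hX).obj (Limits.image (R.γ X.obj))
  let p : (evalX hX).obj (R.ϑlam.obj X.obj) ⟶ Z :=
    (evalX hX).map (Limits.factorThruImage (R.γ X.obj))
  let J : Z ⟶ H := (evalX hX).map (Limits.image.ι (R.γ X.obj)) ≫ i'.hom
  have hpJ : p ≫ J = (evalX hX).map (R.γ X.obj) ≫ i'.hom := by
    refine (Category.assoc _ _ _).symm.trans (congrArg (· ≫ i'.hom) ?_)
    refine ((evalX hX).map_comp _ _).symm.trans ?_
    exact congrArg (evalX hX).map (Limits.image.fac (R.γ X.obj))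
  have hJ : Mono J := by
    have : Mono ((evalX hX).map (Limits.image.ι (R.γ X.obj))) := (evalX hX).map_mono _
    exact mono_comp _ _
  have hp : Epi p := (evalX hX).map_epi (Limits.factorThruImage (R.γ X.obj))
  refine ⟨J.hom.hom, injective_of_mono J, le_antisymm ?_ ?_⟩
  · let C : RMod (Aus X.obj) :=
      FGModuleCat.of (Aus X.obj)ᵐᵒᵖ (HomMod X X.obj ⧸ regularTrace X (HomMod X X.obj))
    let q : H ⟶ C := FGModuleCat.ofHom (regularTrace X (HomMod X X.obj)).mkQ
    -- T is a quotient of ϑ_λ(X), which has no nonzero map to a module vanishing at Λ; hence the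
    -- image of J lies in the trace.
    have h : J ≫ q = 0 := by
      rw [← cancel_epi p, Limits.comp_zero]
      exact hom_eq_zero_of_ϑlam hX R (vanishesAtRegular_quotient_regularTrace hX hΛ _) _
    rintro _ ⟨t, rfl⟩
    exact (Submodule.Quotient.mk_eq_zero _).1 (hom_apply_eq h t)
  · refine regularTrace_le_of_vanishesAtRegular ?_
    let C : RMod (Aus X.obj) :=
      FGModuleCat.of (Aus X.obj)ᵐᵒᵖ (HomMod X X.obj ⧸ LinearMap.range J.hom.hom)
    let q : H ⟶ C := FGModuleCat.ofHom (LinearMap.range J.hom.hom).mkQ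
    have hq : Epi q := epi_of_surjective q (Submodule.mkQ_surjective _)
    have hJq : J ≫ q = 0 := FGModuleCat.hom_ext (LinearMap.ext fun t =>
      (Submodule.Quotient.mk_eq_zero _).2 ⟨t, rfl⟩)
    let c := evalCounitIso hX C
    obtain ⟨q', hq'⟩ := (evalX hX).map_surjective (i'.hom ≫ q ≫ c.inv)
    have : Epi q' := by
      have : Epi ((evalX hX).map q') := hq' ▸ inferInstance
      exact (evalX hX).epi_of_epi_map this
    -- The cokernel of J is a quotient of ϑ_ρ(X) killed by γ, hence lies in the kernel of ϑ;
    -- minimality of the trace gives the other inclusion.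
    have hγ : R.γ X.obj ≫ q' = 0 := by
      refine (evalX hX).map_injective ?_
      rw [(evalX hX).map_comp, hq', ← Category.assoc, ← hpJ, Category.assoc, ← Category.assoc J, hJq,
        Limits.zero_comp, Limits.comp_zero]
      rfl
    have hk := R.kernel_of_γ_comp_eq_zero q' hγ
    exact ((theta_kernel_iff hX hΛ _).1 hk).of_equiv (FGModuleCat.isoToLinearEquiv c)

end Trace

/-! ### Dimension shifting and finite generation by images. -/

section Dimension

variable {R : Type u} [Ring R]

lemma hasProjectiveDimensionLE_one_iff {P N : Type u} [AddCommGroup P] [Module R P]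
    [AddCommGroup N] [Module R N] [Module.Projective R P] {p : P →ₗ[R] N}
    (hp : Function.Surjective p) :
    HasProjectiveDimensionLE (ModuleCat.of R N) 1 ↔ Module.Projective R (LinearMap.ker p) := by
  have he : Function.Exact (LinearMap.ker p).subtype p := fun x => by simp
  let S : ShortComplex (ModuleCat.{u} R) :=
    ModuleCat.shortComplexOfCompEqZero _ _ he.linearMap_comp_eq_zero
  have hS : S.ShortExact := ModuleCat.shortComplex_shortExact S he Subtype.val_injective hp
  have h2 : Projective S.X₂ := (IsProjective.iff_projective P).1 inferInstance
  refine (hS.hasProjectiveDimensionLT_X₃_iff 0 h2).trans ?_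
  rw [zero_add, ← projective_iff_hasProjectiveDimensionLT_one]
  exact (IsProjective.iff_projective (R := R) (LinearMap.ker p)).symm

lemma hasInjectiveDimensionLE_one_iff {E N : Type u} [AddCommGroup E] [Module R E]
    [AddCommGroup N] [Module R N] [Module.Injective R E] {i : N →ₗ[R] E}
    (hi : Function.Injective i) :
    HasInjectiveDimensionLE (ModuleCat.of R N) 1 ↔
      Module.Injective R (E ⧸ LinearMap.range i) := by
  let S : ShortComplex (ModuleCat.{u} R) :=
    ModuleCat.shortComplexOfCompEqZero _ _ i.exact_map_mkQ_range.linearMap_comp_eq_zero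
  have hS : S.ShortExact := ModuleCat.shortComplex_shortExact S i.exact_map_mkQ_range hi
    (Submodule.mkQ_surjective _)
  have h2 : Injective S.X₂ := (Module.injective_iff_injective_object R E).1 inferInstance
  refine (hS.hasInjectiveDimensionLT_X₃_iff 0 h2).symm.trans ?_
  rw [zero_add, ← injective_iff_hasInjectiveDimensionLT_one]
  exact (Module.injective_iff_injective_object R (E ⧸ LinearMap.range i)).symm

lemma exists_injective_embedding (N : Type u) [AddCommGroup N] [Module R N] :
    ∃ (E : Type u) (_ : AddCommGroup E) (_ : Module R E) (i : N →ₗ[R] E),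
      Module.Injective R E ∧ Function.Injective i := by
  obtain ⟨I, _, f, _⟩ := (EnoughInjectives.presentation (ModuleCat.of R N)).some
  exact ⟨I, inferInstance, inferInstance, f.hom,
    (Module.injective_iff_injective_object R I).2 ‹_›, (ModuleCat.mono_iff_injective f).1 ‹_›⟩

/-- A finitely generated module is compact in its lattice of submodules, so finitely many of the
images already cover it. -/
lemma exists_pi_surjective_of_iSup_range_eq_top {T N : Type u} [AddCommGroup T] [Module R T]
    [AddCommGroup N] [Module R N] [Module.Finite R N]
    (h : ⨆ ψ : T →ₗ[R] N, LinearMap.range ψ = ⊤) :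
    ∃ (n : ℕ) (p : (Fin n → T) →ₗ[R] N), Function.Surjective p := by
  obtain ⟨s, hs⟩ := CompleteLattice.IsCompactElement.exists_finset_of_le_iSup _
    ((Submodule.fg_iff_compact (⊤ : Submodule R N)).1 Module.Finite.fg_top)
    (fun ψ : T →ₗ[R] N => LinearMap.range ψ) h.ge
  let e := s.equivFin.symm
  refine ⟨s.card, ∑ k, (e k).1 ∘ₗ LinearMap.proj k, ?_⟩
  rw [← LinearMap.range_eq_top, eq_top_iff]
  refine hs.trans (iSup₂_le fun ψ hψ => ?_)
  rintro _ ⟨t, rfl⟩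
  refine ⟨Pi.single (e.symm ⟨ψ, hψ⟩) t, ?_⟩
  rw [LinearMap.sum_apply, Finset.sum_eq_single (e.symm ⟨ψ, hψ⟩)]
  · simp
  · intro b _ hb
    simp [hb]
  · simp

end Dimension

/-! ### gen(T) and Ker L_λ as the modules equal to their trace. -/

section TraceGen

variable {Λ : Type u} [Ring Λ] {𝒳 : ObjectProperty (RMod Λ)} {X : 𝒳.FullSubcategory}

/-- The inclusion of the `k`-th summand of a free module. -/
def freeι (Λ : Type u) [Ring Λ] (n : ℕ) (k : Fin n) : regular Λ ⟶ free Λ n :=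
  FGModuleCat.ofHom (LinearMap.single Λᵐᵒᵖ (fun _ : Fin n => Λ) k)

/-- The projection to the `k`-th summand of a free module. -/
def freeπ (Λ : Type u) [Ring Λ] (n : ℕ) (k : Fin n) : free Λ n ⟶ regular Λ :=
  FGModuleCat.ofHom (LinearMap.proj (R := Λᵐᵒᵖ) (φ := fun _ : Fin n => Λ) k)

lemma sum_freeπ_freeι (Λ : Type u) [Ring Λ] (n : ℕ) :
    ∑ k, freeπ Λ n k ≫ freeι Λ n k = 𝟙 (free Λ n) := by
  let Φ : (free Λ n ⟶ free Λ n) →+ ((Fin n → Λ) →ₗ[Λᵐᵒᵖ] (Fin n → Λ)) :=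
    { toFun := fun f => f.hom.hom
      map_zero' := rfl
      map_add' := fun _ _ => rfl }
  have hΦ : Function.Injective Φ := fun f g hfg => FGModuleCat.hom_ext hfg
  apply hΦ
  rw [map_sum]
  refine LinearMap.ext fun y => ?_
  rw [LinearMap.sum_apply]
  exact Finset.univ_sum_single y

lemma regularTrace_free (n : ℕ) : regularTrace X (HomMod X (free Λ n)) = ⊤ := by
  refine eq_top_iff.2 fun x _ => ?_
  have h : x = ∑ k, HomMod.map (freeι Λ n k) (HomMod.map (freeπ Λ n k) x) := by
    refine HomMod.ext ?_
    rw [HomMod.hom_sum]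
    simp only [HomMod.map_hom, Category.assoc]
    rw [← Preadditive.comp_sum, sum_freeπ_freeι, Category.comp_id]
  rw [h]
  exact Submodule.sum_mem _ fun k _ => apply_mem_regularTrace _ _

lemma linearMap_eq_zero_of_regularTrace_eq_top {N G : Type u} [AddCommGroup N]
    [Module (Aus X.obj)ᵐᵒᵖ N] [AddCommGroup G] [Module (Aus X.obj)ᵐᵒᵖ G]
    (hN : regularTrace X N = ⊤) (hG : VanishesAtRegular X G) (φ : N →ₗ[(Aus X.obj)ᵐᵒᵖ] G) :
    φ = 0 := by
  rw [← LinearMap.ker_eq_top, eq_top_iff, ← hN]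
  refine iSup_le fun ψ => ?_
  rintro _ ⟨x, rfl⟩
  exact LinearMap.congr_fun (hG (φ ∘ₗ ψ)) x

lemma regularTrace_eq_top_of_surjective {N N' : Type u} [AddCommGroup N]
    [Module (Aus X.obj)ᵐᵒᵖ N] [AddCommGroup N'] [Module (Aus X.obj)ᵐᵒᵖ N']
    {f : N →ₗ[(Aus X.obj)ᵐᵒᵖ] N'} (hf : Function.Surjective f) (hN : regularTrace X N = ⊤) :
    regularTrace X N' = ⊤ := by
  refine eq_top_iff.2 fun x _ => ?_
  obtain ⟨y, rfl⟩ := hf x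
  exact map_regularTrace_le f ⟨y, hN ▸ Submodule.mem_top, rfl⟩

lemma exists_free_surjective_of_regularTrace_eq_top {N : Type u} [AddCommGroup N]
    [Module (Aus X.obj)ᵐᵒᵖ N] [Module.Finite (Aus X.obj)ᵐᵒᵖ N] (hN : regularTrace X N = ⊤) :
    ∃ (n : ℕ) (p : HomMod X (free Λ n) →ₗ[(Aus X.obj)ᵐᵒᵖ] N), Function.Surjective p := by
  obtain ⟨n, p, hp⟩ := exists_pi_surjective_of_iSup_range_eq_top hN
  refine ⟨n, p ∘ₗ LinearMap.pi fun k => HomMod.map (freeπ Λ n k), hp.comp fun g => ?_⟩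
  refine ⟨HomMod.mk (FGModuleCat.ofHom (LinearMap.pi fun k => (g k).hom.hom.hom)), ?_⟩
  rfl

section Embedded

variable {T : Type u} [AddCommGroup T] [Module (Aus X.obj)ᵐᵒᵖ T]
  {j : T →ₗ[(Aus X.obj)ᵐᵒᵖ] HomMod X X.obj} (hj : Function.Injective j)
  (hjr : LinearMap.range j = regularTrace X (HomMod X X.obj))
include hj hjr

/-- Every map Hom(X, Λ) → Hom(X, X) lands in the range of j, hence factors through T; so the trace
in T already fills T. -/
lemma regularTrace_eq_top_of_embedding : regularTrace X T = ⊤ := by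
  have key : regularTrace X (HomMod X X.obj) ≤ (regularTrace X T).map j := by
    refine iSup_le fun φ => ?_
    obtain ⟨φ', rfl⟩ := exists_linear_lift hj φ fun x => hjr ▸ apply_mem_regularTrace φ x
    rintro _ ⟨x, rfl⟩
    exact ⟨φ' x, apply_mem_regularTrace φ' x, rfl⟩
  refine eq_top_iff.2 fun t _ => ?_
  obtain ⟨t', ht', e⟩ := key (hjr ▸ LinearMap.mem_range_self j t)
  exact hj e ▸ ht'

-- Λ is a summand of some X^n, so each element of Hom(X, Λ) is a sum of terms obtained by passing to
-- X and back. The part in Hom(X, X) lies in the trace, that is, comes from T, so any map from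
-- Hom(X, Λ) has its image covered by maps from T.
omit hj in
lemma iSup_range_eq_top_of_embedding (hX : IsAddGenerator 𝒳 X) (hΛ : 𝒳 (regular Λ))
    {N : Type u} [AddCommGroup N] [Module (Aus X.obj)ᵐᵒᵖ N] (hN : regularTrace X N = ⊤) :
    ⨆ ψ : T →ₗ[(Aus X.obj)ᵐᵒᵖ] N, LinearMap.range ψ = ⊤ := by
  rw [eq_top_iff, ← hN]
  refine iSup_le fun φ => ?_
  rintro _ ⟨x, rfl⟩
  obtain ⟨n, s, r, h⟩ := HomMod.exists_sum_retract hX hΛ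
  have hx : x = ∑ k, HomMod.map (r k) (HomMod.map (s k) x) := by
    refine HomMod.ext ?_
    rw [HomMod.hom_sum]
    simp only [HomMod.map_hom, Category.assoc]
    rw [← Preadditive.comp_sum, h, Category.comp_id]
  rw [hx, map_sum]
  refine Submodule.sum_mem _ fun k _ => ?_
  obtain ⟨t, ht⟩ : HomMod.map (s k) x ∈ LinearMap.range j :=
    hjr ▸ apply_mem_regularTrace (HomMod.map (s k)) x
  rw [← ht]
  exact le_iSup (fun ψ : T →ₗ[(Aus X.obj)ᵐᵒᵖ] N => LinearMap.range ψ) (φ ∘ₗ HomMod.map (r k) ∘ₗ j)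
    ⟨t, rfl⟩

end Embedded

lemma gen_iff_regularTrace_eq_top (hX : IsAddGenerator 𝒳 X) (hΛ : 𝒳 (regular Λ))
    {T : RMod (Aus X.obj)} {j : T →ₗ[(Aus X.obj)ᵐᵒᵖ] HomMod X X.obj}
    (hj : Function.Injective j) (hjr : LinearMap.range j = regularTrace X (HomMod X X.obj))
    (N : RMod (Aus X.obj)) : gen T N ↔ regularTrace X N = ⊤ := by
  constructor
  · rintro ⟨n, p, hp⟩
    refine regularTrace_eq_top_of_surjective hp (eq_top_iff.2 fun t _ => ?_)
    have h : t = ∑ k, LinearMap.single (Aus X.obj)ᵐᵒᵖ (fun _ : Fin n => (T : Type u)) k (t k) :=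
      (Finset.univ_sum_single t).symm
    rw [h]
    refine Submodule.sum_mem _ fun k _ => map_regularTrace_le _ ⟨t k, ?_, rfl⟩
    exact regularTrace_eq_top_of_embedding hj hjr ▸ Submodule.mem_top
  · intro hN
    exact exists_pi_surjective_of_iSup_range_eq_top (iSup_range_eq_top_of_embedding hjr hX hΛ hN)

/-- The quotient of N by its trace is in Ker μ, so a module orthogonal to Ker μ has zero quotient.
-/
lemma ℓlam_kernel_iff_regularTrace_eq_top [IsArtinAlgebra Λ] (hX : IsAddGenerator 𝒳 X)
    (hΛ : 𝒳 (regular Λ)) (S : RecollementΓ hX) (N : RMod (Aus X.obj)) :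
    S.ℓlam.kernel N ↔ regularTrace X N = ⊤ := by
  rw [ℓlam_kernel_iff hX hΛ]
  refine ⟨fun h => ?_, fun h G hG φ => linearMap_eq_zero_of_regularTrace_eq_top h hG φ⟩
  have h0 := h (FGModuleCat.of _ (N ⧸ regularTrace X N))
    (vanishesAtRegular_quotient_regularTrace hX hΛ N) (regularTrace X N).mkQ
  rw [← (regularTrace X N).ker_mkQ]
  exact LinearMap.ker_eq_top.2 h0

end TraceGen

/-! ### Images, cokernels and kernels. -/

section ImagesCokernels

variable {Λ : Type u} [Ring Λ]

/-- `d` factors as a surjection followed by an injection. -/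
lemma exists_image_factorization {M N : RMod Λ} (d : M ⟶ N) :
    ∃ (I : RMod Λ) (p : M ⟶ I) (i : I ⟶ N), Function.Surjective p.hom.hom ∧
      Function.Injective i.hom.hom ∧ p ≫ i = d :=
  ⟨FGModuleCat.of Λᵐᵒᵖ (LinearMap.range d.hom.hom),
    FGModuleCat.ofHom d.hom.hom.rangeRestrict, FGModuleCat.ofHom (LinearMap.range d.hom.hom).subtype,
    LinearMap.surjective_rangeRestrict _, Subtype.val_injective, FGModuleCat.hom_ext rfl⟩

/-- The cokernel of a morphism. -/
lemma exists_cokernel {K M : RMod Λ} (i : K ⟶ M) :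
    ∃ (C : RMod Λ) (p : M ⟶ C), Function.Surjective p.hom.hom ∧
      ∀ x, p.hom.hom x = 0 ↔ x ∈ LinearMap.range i.hom.hom :=
  ⟨FGModuleCat.of Λᵐᵒᵖ (M ⧸ LinearMap.range i.hom.hom),
    FGModuleCat.ofHom (LinearMap.range i.hom.hom).mkQ, Submodule.mkQ_surjective _,
    fun _ => Submodule.Quotient.mk_eq_zero _⟩

end ImagesCokernels

/-! ### Modules receiving no maps from Ker μ. -/

section TorsionFree

variable {Λ : Type u} [Ring Λ] [IsArtinAlgebra Λ] {𝒳 : ObjectProperty (RMod Λ)}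
  {X : 𝒳.FullSubcategory}

/-- The kernel of a morphism. -/
lemma exists_kernel {M N : RMod Λ} (d : M ⟶ N) :
    ∃ (K : RMod Λ) (i : K ⟶ M), Function.Injective i.hom.hom ∧ i ≫ d = 0 ∧
      (∀ x, d.hom.hom x = 0 → x ∈ LinearMap.range i.hom.hom) ∧
      ∀ {L : RMod Λ} (f : L ⟶ M), f ≫ d = 0 → ∃ g : L ⟶ K, g ≫ i = f := by
  let K : RMod Λ := FGModuleCat.of Λᵐᵒᵖ (LinearMap.ker d.hom.hom)
  let i : K ⟶ M := FGModuleCat.ofHom (LinearMap.ker d.hom.hom).subtype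
  have hi : Function.Injective i.hom.hom := Subtype.val_injective
  refine ⟨K, i, hi, FGModuleCat.hom_ext (LinearMap.ext fun x => LinearMap.mem_ker.1 x.2),
    fun x hx => ⟨⟨x, hx⟩, rfl⟩, fun f hf => exists_lift_of_injective hi f fun x => ⟨⟨f.hom.hom x, hom_apply_eq hf x⟩, rfl⟩⟩

/-- A module without nonzero maps from modules vanishing at `Λ` is the cokernel of some
`Hom(X, i)` with `i` injective. -/
lemma exists_injective_presentation (hΛ : 𝒳 (regular Λ)) (hsub : 𝒳.IsClosedUnderSubobjects)
    (hX : IsAddGenerator 𝒳 X) (N : RMod (Aus X.obj))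
    (hN : ∀ G : RMod (Aus X.obj), VanishesAtRegular X G →
      ∀ φ : G →ₗ[(Aus X.obj)ᵐᵒᵖ] N, φ = 0) :
    ∃ (I Y : RMod Λ) (_ : 𝒳 Y) (i : I ⟶ Y) (p : HomMod X Y →ₗ[(Aus X.obj)ᵐᵒᵖ] N),
      Function.Injective i.hom.hom ∧ Function.Surjective p ∧
        LinearMap.ker p = LinearMap.range (HomMod.map (X := X) i) := by
  obtain ⟨Y, hY, p, hp⟩ := HomMod.exists_surjective hX N
  have := HomMod.finite hX hY
  obtain ⟨Y₁, hY₁, q, hq⟩ := HomMod.exists_surjective hX (LinearMap.ker p)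
  obtain ⟨d, hd⟩ := HomMod.exists_map_eq hX hY₁ ((LinearMap.ker p).subtype ∘ₗ q)
  obtain ⟨I, d', i, hd', hi, rfl⟩ := exists_image_factorization d
  have hI : 𝒳 I := prop_of_injective hsub i hi hY
  have := HomMod.finite hX hI
  let G : RMod (Aus X.obj) := FGModuleCat.of _
    (HomMod X I ⧸ LinearMap.range (HomMod.map (X := X) d'))
  -- G measures the failure of Hom(X, d') to be onto. Maps Λ → I lift along the surjection d', so G
  -- vanishes at Λ.
  have hG : VanishesAtRegular X G := by
    intro φ
    have := HomMod.projective hX hΛ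
    obtain ⟨ψ, rfl⟩ := Module.projective_lifting_property
      (LinearMap.range (HomMod.map (X := X) d')).mkQ φ (Submodule.mkQ_surjective _)
    obtain ⟨f, rfl⟩ := HomMod.exists_map_eq hX hΛ ψ
    obtain ⟨g, rfl⟩ := exists_lift_of_prj (prj_regular Λ) d' f fun x => hd' _
    refine LinearMap.ext fun x => (Submodule.Quotient.mk_eq_zero _).2 ⟨HomMod.map g x, ?_⟩
    rw [HomMod.map_comp]
    rfl
  have hle : LinearMap.range (HomMod.map (X := X) d') ≤
      LinearMap.ker (p ∘ₗ HomMod.map (X := X) i) := by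
    rintro _ ⟨x, rfl⟩
    have h := LinearMap.congr_fun hd x
    rw [HomMod.map_comp] at h
    exact (congrArg p h).trans (LinearMap.mem_ker.1 (q x).2)
  -- The map G → N induced by p ∘ Hom(X, i) is zero, so all of Hom(X, I), not only the image of
  -- Hom(X, Y₁), goes into the kernel of p.
  have h0 := hN G hG ((LinearMap.range (HomMod.map (X := X) d')).liftQ _ hle)
  refine ⟨I, Y, hY, i, p, hi, hp, le_antisymm (fun x hx => ?_) ?_⟩
  · obtain ⟨y, hy⟩ := hq ⟨x, hx⟩
    refine ⟨HomMod.map d' y, ?_⟩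
    have h := LinearMap.congr_fun hd y
    rw [HomMod.map_comp] at h
    exact h.trans (congrArg Subtype.val hy)
  · rintro _ ⟨x, rfl⟩
    exact LinearMap.congr_fun h0 (Submodule.Quotient.mk x)

/-- Cover G by Hom(X, Z) and lift φ to a map f : Z → Y. On a free cover q of Z the map f takes
values in Ker p, since Hom(X, Λ^m) → G is zero. Projectivity of Ker p realises this restriction by a
map from the free module into an object W of 𝒳; that map descends to Z, so f itself takes values in
Ker p and φ = 0. -/
lemma linearMap_eq_zero_of_projective_ker (hprj : prj Λ ≤ 𝒳)
    (hsub : 𝒳.IsClosedUnderSubobjects) (hX : IsAddGenerator 𝒳 X) {N : Type u} [AddCommGroup N]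
    [Module (Aus X.obj)ᵐᵒᵖ N] {Y : RMod Λ} (hY : 𝒳 Y)
    {p : HomMod X Y →ₗ[(Aus X.obj)ᵐᵒᵖ] N} (hp : Function.Surjective p)
    (hK : Module.Projective (Aus X.obj)ᵐᵒᵖ (LinearMap.ker p)) (G : RMod (Aus X.obj))
    (hG : VanishesAtRegular X G) (φ : G →ₗ[(Aus X.obj)ᵐᵒᵖ] N) : φ = 0 := by
  obtain ⟨Z, hZ, c, hc⟩ := HomMod.exists_surjective hX G
  have := HomMod.projective hX hZ
  have := HomMod.finite hX hY
  obtain ⟨ψ, hψ⟩ := Module.projective_lifting_property p (φ ∘ₗ c) hp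
  obtain ⟨f, rfl⟩ := HomMod.exists_map_eq hX hZ ψ
  obtain ⟨m, q, hq⟩ := exists_free_surjective Z
  have hfree : 𝒳 (free Λ m) := hprj _ (prj_free m)
  have hcq : c ∘ₗ HomMod.map q = 0 :=
    linearMap_eq_zero_of_regularTrace_eq_top (regularTrace_free m) hG _
  have hker : ∀ x, HomMod.map (X := X) (q ≫ f) x ∈ LinearMap.ker p := fun x => by
    rw [HomMod.map_comp, LinearMap.mem_ker]
    refine (LinearMap.congr_fun hψ (HomMod.map q x)).trans ?_
    exact (congrArg φ (LinearMap.congr_fun hcq x)).trans (map_zero φ)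
  let g := LinearMap.codRestrict (LinearMap.ker p) (HomMod.map (X := X) (q ≫ f)) hker
  obtain ⟨W, hW, r, hr⟩ := HomMod.exists_surjective hX (LinearMap.ker p)
  -- Here projectivity of Ker p enters: it becomes a summand of Hom(X, W), so g is represented by a
  -- module map w.
  obtain ⟨s, hs⟩ := Module.projective_lifting_property r LinearMap.id hr
  obtain ⟨w, hw⟩ := HomMod.exists_map_eq hX hfree (s ∘ₗ g)
  obtain ⟨K, i, hi, hiq, hker', -⟩ := exists_kernel q
  have hKX : 𝒳 K := prop_of_injective hsub i hi hfree
  have hgi : g ∘ₗ HomMod.map i = 0 := by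
    refine LinearMap.ext fun x => Subtype.ext ?_
    change (HomMod.map (q ≫ f) (HomMod.map i x)).hom = 0
    rw [HomMod.map_hom, HomMod.map_hom, Category.assoc, ← Category.assoc i, hiq,
      Limits.zero_comp, Limits.comp_zero]
  -- The kernel K of q is in 𝒳, so vanishing can be tested on maps from X; this is what lets w
  -- descend along q.
  have hiw : i ≫ w = 0 := by
    refine HomMod.map_ext hX hKX ?_
    rw [HomMod.map_comp, hw, LinearMap.comp_assoc, hgi, LinearMap.comp_zero]
    exact LinearMap.ext fun x => (Limits.comp_zero (f := x.hom)).symm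
  obtain ⟨v, rfl⟩ := exists_desc hq w fun x hx => by
    obtain ⟨y, rfl⟩ := hker' x hx
    exact hom_apply_eq hiw y
  obtain ⟨f', hf'⟩ := HomMod.exists_map_eq hX hZ
    ((LinearMap.ker p).subtype ∘ₗ r ∘ₗ HomMod.map v)
  have hff' : f' = f := by
    refine comp_cancel_of_surjective hq (HomMod.map_ext hX hfree ?_)
    rw [HomMod.map_comp, hf']
    refine LinearMap.ext fun x => ?_
    have h1 := LinearMap.congr_fun hw x
    rw [HomMod.map_comp] at h1
    exact congrArg Subtype.val ((congrArg r h1).trans (LinearMap.congr_fun hs (g x)))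
  refine LinearMap.ext fun y => ?_
  obtain ⟨x, rfl⟩ := hc y
  refine (LinearMap.congr_fun hψ x).symm.trans ?_
  rw [← hff', hf']
  exact LinearMap.mem_ker.1 (r (HomMod.map v x)).2

end TorsionFree

/-! ### Part (i): Ker L_ρ, projective dimension and cogen(T). -/

section ProjectiveDimension

variable {Λ : Type u} [Ring Λ] [IsArtinAlgebra Λ] {𝒳 : ObjectProperty (RMod Λ)}
  {X : 𝒳.FullSubcategory}

theorem ℓrho_kernel_eq_projDimLEOne (hprj : prj Λ ≤ 𝒳) (hsub : 𝒳.IsClosedUnderSubobjects)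
    (hX : IsAddGenerator 𝒳 X) (S : RecollementΓ hX) :
    S.ℓrho.kernel = projDimLEOne (Aus X.obj) := by
  have hΛ : 𝒳 (regular Λ) := hprj _ (prj_regular Λ)
  ext N
  rw [ℓrho_kernel_iff hX hΛ]
  constructor
  · intro h
    obtain ⟨I, Y, hY, i, p, hi, hp, hk⟩ := exists_injective_presentation hΛ hsub hX N h
    have := HomMod.projective hX hY
    have := HomMod.projective hX (prop_of_injective hsub i hi hY)
    refine (hasProjectiveDimensionLE_one_iff hp).2 ?_
    rw [hk]
    exact Module.Projective.of_equiv (LinearEquiv.ofInjective _ (HomMod.map_injective hi))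
  · intro h
    obtain ⟨Y, hY, p, hp⟩ := HomMod.exists_surjective hX N
    have := HomMod.projective hX hY
    exact linearMap_eq_zero_of_projective_ker hprj hsub hX hY hp
      ((hasProjectiveDimensionLE_one_iff hp).1 h)

theorem cogen_le_ℓrho_kernel (hprj : prj Λ ≤ 𝒳) (hsub : 𝒳.IsClosedUnderSubobjects)
    (hX : IsAddGenerator 𝒳 X) (S : RecollementΓ hX) {T : RMod (Aus X.obj)}
    {j : T →ₗ[(Aus X.obj)ᵐᵒᵖ] HomMod X X.obj} (hj : Function.Injective j) :
    cogen T ≤ S.ℓrho.kernel := by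
  rintro N ⟨n, i, hi⟩
  rw [ℓrho_kernel_iff hX (hprj _ (prj_regular Λ))]
  intro G hG φ
  -- Hom(X, X) receives no nonzero map from Ker μ: take p to be the identity, whose kernel is zero
  -- and so projective.
  have h : ∀ k, j ∘ₗ LinearMap.proj k ∘ₗ i ∘ₗ φ = 0 := fun k =>
    linearMap_eq_zero_of_projective_ker hprj hsub hX X.property (p := LinearMap.id)
      Function.surjective_id (by rw [LinearMap.ker_id]; infer_instance) G hG _
  refine LinearMap.ext fun x => hi (funext fun k => hj ?_)
  refine (LinearMap.congr_fun (h k) x).trans ?_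
  rw [LinearMap.zero_apply, LinearMap.zero_apply, map_zero, Pi.zero_apply, map_zero]

/-- Write N as the cokernel of Hom(X, I) → Hom(X, Y) and embed Y in a free module F. The cokernel C
of I → F again embeds in a free module, so it is in 𝒳. Then N embeds in Hom(X, C) with image inside
that of Hom(X, F), hence inside the trace of Hom(X, Λ); splitting C off X^m sends this into copies
of T. -/
theorem ℓrho_kernel_le_cogen (hprj : prj Λ ≤ 𝒳) (hsub : 𝒳.IsClosedUnderSubobjects)
    (hX : IsAddGenerator 𝒳 X) (S : RecollementΓ hX)
    (hcog : ∀ M : RMod Λ, ∃ (n : ℕ) (i : M ⟶ free Λ n), Function.Injective i.hom.hom)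
    {T : RMod (Aus X.obj)} {j : T →ₗ[(Aus X.obj)ᵐᵒᵖ] HomMod X X.obj}
    (hj : Function.Injective j) (hjr : LinearMap.range j = regularTrace X (HomMod X X.obj)) :
    S.ℓrho.kernel ≤ cogen T := by
  have hΛ : 𝒳 (regular Λ) := hprj _ (prj_regular Λ)
  intro N hN
  obtain ⟨I, Y, hY, i, p, hi, hp, hk⟩ :=
    exists_injective_presentation hΛ hsub hX N ((ℓrho_kernel_iff hX hΛ S N).1 hN)
  obtain ⟨n, k, hk'⟩ := hcog Y
  obtain ⟨C, π, hπ, hker⟩ := exists_cokernel (i ≫ k)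
  have hC : 𝒳 C := by
    obtain ⟨m, c, hc⟩ := hcog C
    exact prop_of_injective hsub c hc (hprj _ (prj_free m))
  -- A map X → Y dies in C exactly when it factors through I, because k is injective; so p and
  -- Hom(X, k ≫ π) have the same kernel.
  have hz : ∀ x, p x = 0 ↔ HomMod.map (X := X) (k ≫ π) x = 0 := by
    intro x
    rw [← LinearMap.mem_ker, hk]
    constructor
    · rintro ⟨y, rfl⟩
      refine HomMod.ext (FGModuleCat.hom_ext (LinearMap.ext fun a => ?_))
      exact (hker _).2 ⟨y.hom.hom.hom a, rfl⟩
    · intro hx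
      obtain ⟨g, hg⟩ := exists_lift_of_injective hi x.hom fun a => by
        obtain ⟨b, hb⟩ := (hker (k.hom.hom (x.hom.hom.hom a))).1
          (hom_apply_eq (congrArg HomMod.hom hx) a)
        exact ⟨b, hk' hb⟩
      exact ⟨HomMod.mk g, hg⟩
  obtain ⟨ν, hν⟩ := exists_linear_desc hp (HomMod.map (X := X) (k ≫ π)) fun x => (hz x).1
  have hνi : Function.Injective ν := by
    refine (injective_iff_map_eq_zero ν).2 fun y hy => ?_
    obtain ⟨x, rfl⟩ := hp y
    exact (hz x).2 ((LinearMap.congr_fun hν x).symm.trans hy)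
  obtain ⟨m, s, r, e⟩ := HomMod.exists_sum_retract hX hC
  have hlift : ∀ l, ∃ t : N →ₗ[(Aus X.obj)ᵐᵒᵖ] T, j ∘ₗ t = HomMod.map (s l) ∘ₗ ν := fun l =>
    exists_linear_lift hj _ fun y => by
      obtain ⟨x, rfl⟩ := hp y
      have hx : ν (p x) = HomMod.map π (HomMod.map k x) := by
        refine (LinearMap.congr_fun hν x).trans ?_
        rw [HomMod.map_comp]
        rfl
      rw [hjr, LinearMap.comp_apply, hx]
      refine map_regularTrace_le _ ⟨_, map_regularTrace_le (HomMod.map π)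
        ⟨HomMod.map k x, ?_, rfl⟩, rfl⟩
      rw [regularTrace_free]
      exact Submodule.mem_top
  choose t ht using hlift
  refine ⟨m, LinearMap.pi t, (injective_iff_map_eq_zero _).2 fun y hy => hνi ?_⟩
  -- The components s l are jointly split monic on C, so vanishing of all of them forces ν y = 0.
  have hs : ∀ l, (ν y).hom ≫ s l = 0 := fun l =>
    congrArg HomMod.hom ((LinearMap.congr_fun (ht l) y).symm.trans
      ((congrArg j (congrFun hy l)).trans (map_zero j)))
  rw [map_zero]
  refine HomMod.ext ?_
  rw [← Category.comp_id (ν y).hom, ← e, Preadditive.comp_sum]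
  refine Finset.sum_eq_zero fun l _ => ?_
  rw [← Category.assoc, hs, Limits.zero_comp]

end ProjectiveDimension

/-! ### Part (ii): injective dimension and gen(T). -/

section InjectiveDimension

variable {Λ : Type u} [Ring Λ] {𝒳 : ObjectProperty (RMod Λ)}
  {X : 𝒳.FullSubcategory}

/-- Vanishing of `Ext¹(Y/K, Λ)` lets maps from `K` to a free module extend to `Y`. -/
lemma exists_extension_to_free (hperp : 𝒳 ≤ leftPerp Λ) {K Y C : RMod Λ} (hC : 𝒳 C) {i : K ⟶ Y}
    (hi : Function.Injective i.hom.hom) {d : Y ⟶ C} (hd : Function.Surjective d.hom.hom)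
    (hid : ∀ x, d.hom.hom x = 0 ↔ x ∈ LinearMap.range i.hom.hom) {n : ℕ} (a : K ⟶ free Λ n) :
    ∃ b : Y ⟶ free Λ n, i ≫ b = a := by
  have he : Function.Exact i.hom.hom d.hom.hom := hid
  let S : ShortComplex (ModuleCat.{u} Λᵐᵒᵖ) :=
    ModuleCat.shortComplexOfCompEqZero _ _ he.linearMap_comp_eq_zero
  have hS : S.ShortExact := ModuleCat.shortComplex_shortExact S he hi hd
  have key : ∀ a : K ⟶ regular Λ, ∃ b : Y ⟶ regular Λ, i ≫ b = a := by
    intro a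
    have hsub : Subsingleton (Abelian.Ext S.X₃ (regular Λ).obj 1) := hperp _ hC 1 le_rfl
    obtain ⟨x, hx⟩ := Abelian.Ext.contravariant_sequence_exact₁ hS (regular Λ).obj
      (Abelian.Ext.mk₀ a.hom) (add_zero 1) (Subsingleton.elim _ _)
    obtain ⟨b, rfl⟩ := Abelian.Ext.homEquiv₀.symm.surjective x
    refine ⟨ObjectProperty.homMk b, ObjectProperty.hom_ext _ ?_⟩
    exact Abelian.Ext.homEquiv₀.symm.injective ((Abelian.Ext.mk₀_comp_mk₀ _ _).symm.trans hx)
  choose b hb using fun k => key (a ≫ freeπ Λ n k)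
  refine ⟨ObjectProperty.homMk (ModuleCat.ofHom (LinearMap.pi fun k => (b k).hom.hom)),
    FGModuleCat.hom_ext (LinearMap.ext fun x => funext fun k => ?_)⟩
  exact hom_apply_eq (hb k) x

/-- Baer's criterion for E/N: a map g from a left ideal I of Γᵐᵒᵖ must first be lifted to E, after
which injectivity of E extends it. A lift h exists on a projective cover Hom(X, Y) → I, and its
restriction to the kernel Hom(X, K) takes values in N. That restriction extends to Hom(X, Y) with
values in N, and subtracting the extension makes h descend to I. -/
theorem hasInjectiveDimensionLE_one_of_regularTrace_eq_top [IsArtinAlgebra Λ]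
    (hsub : 𝒳.IsClosedUnderSubobjects) (hperp : 𝒳 ≤ leftPerp Λ) (hX : IsAddGenerator 𝒳 X)
    {N : Type u} [AddCommGroup N] [Module (Aus X.obj)ᵐᵒᵖ N] [Module.Finite (Aus X.obj)ᵐᵒᵖ N]
    (hN : regularTrace X N = ⊤) :
    HasInjectiveDimensionLE (ModuleCat.of (Aus X.obj)ᵐᵒᵖ N) 1 := by
  obtain ⟨n, c, hc⟩ := exists_free_surjective_of_regularTrace_eq_top hN
  obtain ⟨E, _, _, ι, hE, hι⟩ := exists_injective_embedding (R := (Aus X.obj)ᵐᵒᵖ) N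
  rw [hasInjectiveDimensionLE_one_iff hι]
  refine Module.Baer.injective fun I g => ?_
  obtain ⟨Y, hY, p, hp⟩ := HomMod.exists_surjective hX I
  have := HomMod.projective hX hY
  let u : (Aus X.obj)ᵐᵒᵖ →ₗ[(Aus X.obj)ᵐᵒᵖ] HomMod X X.obj :=
    { toFun := fun a => HomMod.mk (FGModuleCat.ofHom a.unop)
      map_add' := fun _ _ => rfl
      map_smul' := fun _ _ => rfl }
  have hu : Function.Injective u := fun a b h =>
    MulOpposite.unop_injective (congrArg (fun q : HomMod X X.obj => q.hom.hom.hom) h)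
  -- Viewing the ideal inside Hom(X, X), its cover becomes Hom(X, d) for a map d : Y → X. The image
  -- of d embeds in X, hence is in 𝒳, where Ext¹(-, Λ) vanishes.
  obtain ⟨d, hd⟩ := HomMod.exists_map_eq hX hY (u ∘ₗ I.subtype ∘ₗ p)
  have hpd : ∀ x, p x = 0 ↔ x.hom ≫ d = 0 := fun x => by
    have h : x.hom ≫ d = (u (p x)).hom := congrArg HomMod.hom (LinearMap.congr_fun hd x)
    rw [h]
    constructor
    · intro hx
      rw [hx]
      exact congrArg HomMod.hom (map_zero u)
    · intro hx
      exact Subtype.ext (hu ((show u (p x) = 0 from hx).trans (map_zero u).symm))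
  obtain ⟨C, d', e, hd', he, rfl⟩ := exists_image_factorization d
  have hC : 𝒳 C := prop_of_injective hsub e he X.property
  obtain ⟨K, i, hi, hid, hker, hK⟩ := exists_kernel d'
  have hKX : 𝒳 K := prop_of_injective hsub i hi hY
  have hpi : ∀ x, p (HomMod.map i x) = 0 := fun x => by
    rw [hpd, HomMod.map_hom, Category.assoc, ← Category.assoc i, hid, Limits.zero_comp,
      Limits.comp_zero]
  obtain ⟨h, hh⟩ := Module.projective_lifting_property (LinearMap.range ι).mkQ (g ∘ₗ p)
    (Submodule.mkQ_surjective _)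
  obtain ⟨φ, hφ⟩ := exists_linear_lift hι (h ∘ₗ HomMod.map i) fun x => by
    rw [← Submodule.Quotient.mk_eq_zero]
    refine (LinearMap.congr_fun hh (HomMod.map i x)).trans ?_
    exact (congrArg g (hpi x)).trans (map_zero g)
  have := HomMod.projective hX hKX
  -- Since N is a quotient of Hom(X, Λ^n), the restriction of h to Hom(X, K) comes from a map a : K
  -- → Λ^n, and a extends to Y.
  obtain ⟨ψ, hψ⟩ := Module.projective_lifting_property c φ hc
  obtain ⟨a, rfl⟩ := HomMod.exists_map_eq hX hKX ψ
  obtain ⟨b, rfl⟩ := exists_extension_to_free hperp hC hi hd'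
    (fun x => ⟨hker x, by rintro ⟨y, rfl⟩; exact hom_apply_eq hid y⟩) a
  obtain ⟨h', hh'⟩ := exists_linear_desc hp (h - ι ∘ₗ c ∘ₗ HomMod.map b) fun x hx => by
    have hx' : (x.hom ≫ d') ≫ e = 0 := (Category.assoc _ _ _).trans ((hpd x).1 hx)
    have := mono_of_injective e he
    obtain ⟨y, hy⟩ := hK x.hom ((cancel_mono e).1 (hx'.trans Limits.zero_comp.symm))
    have hxy : x = HomMod.map i (HomMod.mk y) := HomMod.ext hy.symm
    have e1 := LinearMap.congr_fun hφ (HomMod.mk y)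
    rw [← hψ, HomMod.map_comp] at e1
    rw [hxy]
    exact sub_eq_zero.2 e1.symm
  obtain ⟨k, hk⟩ := hE.out I.subtype Subtype.val_injective h'
  refine ⟨(LinearMap.range ι).mkQ ∘ₗ k, fun x hx => ?_⟩
  obtain ⟨y, hy⟩ := hp ⟨x, hx⟩
  rw [LinearMap.comp_apply, show k x = h' ⟨x, hx⟩ from hk ⟨x, hx⟩, ← hy]
  have e1 : h' (p y) = h y - ι (c (HomMod.map b y)) := LinearMap.congr_fun hh' y
  rw [e1, map_sub]
  have e2 : (LinearMap.range ι).mkQ (ι (c (HomMod.map b y))) = 0 :=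
    (Submodule.Quotient.mk_eq_zero _).2 ⟨_, rfl⟩
  rw [e2, sub_zero]
  exact LinearMap.congr_fun hh y

/-- Embed Y in a free module Λ^n with cokernel C, which is in 𝒳. The obstruction to extending f :
Hom(X, Y) → N to Hom(X, Λ^n) is a map from the image of Hom(X, π) to E/N. As E/N is injective it
extends to Hom(X, C), and as that is projective it lifts to E, giving the correction. The extension
of f is onto, so N is a quotient of Hom(X, Λ^n). -/
theorem regularTrace_eq_top_of_hasInjectiveDimensionLE_one (hprj : prj Λ ≤ 𝒳)
    (hsub : 𝒳.IsClosedUnderSubobjects) (hX : IsAddGenerator 𝒳 X)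
    (hcog : ∀ M : RMod Λ, ∃ (n : ℕ) (i : M ⟶ free Λ n), Function.Injective i.hom.hom)
    {N : Type u} [AddCommGroup N] [Module (Aus X.obj)ᵐᵒᵖ N] [Module.Finite (Aus X.obj)ᵐᵒᵖ N]
    (hN : HasInjectiveDimensionLE (ModuleCat.of (Aus X.obj)ᵐᵒᵖ N) 1) :
    regularTrace X N = ⊤ := by
  obtain ⟨E, _, _, ι, hE, hι⟩ := exists_injective_embedding (R := (Aus X.obj)ᵐᵒᵖ) N
  rw [hasInjectiveDimensionLE_one_iff hι] at hN
  obtain ⟨Y, hY, f, hf⟩ := HomMod.exists_surjective hX N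
  obtain ⟨n, k, hk⟩ := hcog Y
  obtain ⟨C, π, hπ, hker⟩ := exists_cokernel k
  have hC : 𝒳 C := by
    obtain ⟨m, c, hc⟩ := hcog C
    exact prop_of_injective hsub c hc (hprj _ (prj_free m))
  have hkπ : k ≫ π = 0 :=
    FGModuleCat.hom_ext (LinearMap.ext fun x => (hker _).2 ⟨x, rfl⟩)
  obtain ⟨h, hh⟩ := hE.out (HomMod.map (X := X) k) (HomMod.map_injective hk) (ι ∘ₗ f)
  obtain ⟨ξ₀, hξ₀⟩ := exists_linear_desc
    (LinearMap.surjective_rangeRestrict (HomMod.map (X := X) π)) ((LinearMap.range ι).mkQ ∘ₗ h)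
    fun x hx => by
      have hx' : x.hom ≫ π = 0 := congrArg HomMod.hom (congrArg Subtype.val hx)
      obtain ⟨y, hy⟩ := exists_lift_of_injective hk x.hom fun a =>
        (hker _).1 (hom_apply_eq hx' a)
      have hxy : x = HomMod.map k (HomMod.mk y) := HomMod.ext hy.symm
      rw [hxy, LinearMap.comp_apply, hh]
      exact (Submodule.Quotient.mk_eq_zero _).2 ⟨_, rfl⟩
  obtain ⟨ξ, hξ⟩ := hN.out (LinearMap.range (HomMod.map (X := X) π)).subtype
    Subtype.val_injective ξ₀
  have := HomMod.projective hX hC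
  obtain ⟨ξ', hξ'⟩ := Module.projective_lifting_property (LinearMap.range ι).mkQ ξ
    (Submodule.mkQ_surjective _)
  -- The corrected map takes values in N, and the correction vanishes on Hom(X, Y) because k ≫ π =
  -- 0; hence f' extends f.
  obtain ⟨f', hf'⟩ := exists_linear_lift hι (h - ξ' ∘ₗ HomMod.map π) fun x => by
    rw [← Submodule.Quotient.mk_eq_zero]
    change (LinearMap.range ι).mkQ (h x - ξ' (HomMod.map π x)) = 0
    have e1 : (LinearMap.range ι).mkQ (ξ' (HomMod.map π x)) = (LinearMap.range ι).mkQ (h x) :=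
      (LinearMap.congr_fun hξ' _).trans ((hξ ⟨HomMod.map π x, x, rfl⟩).trans
        (LinearMap.congr_fun hξ₀ x))
    rw [map_sub, e1, sub_self]
  refine regularTrace_eq_top_of_surjective (f := f') (fun y => ?_) (regularTrace_free n)
  obtain ⟨x, rfl⟩ := hf y
  refine ⟨HomMod.map k x, hι ?_⟩
  have e1 := LinearMap.congr_fun hf' (HomMod.map k x)
  have e2 : HomMod.map π (HomMod.map k x) = 0 := by
    refine HomMod.ext ?_
    rw [HomMod.map_hom, HomMod.map_hom, Category.assoc, hkπ, Limits.comp_zero]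
    rfl
  refine e1.trans ?_
  change h (HomMod.map k x) - ξ' (HomMod.map π (HomMod.map k x)) = ι (f x)
  rw [e2, map_zero, sub_zero, hh]
  rfl

end InjectiveDimension

/-! ### Embedding modules in free modules over a self-injective algebra. -/

section Cogenerator

lemma exists_finset_inf_le {R M ι : Type*} [Ring R] [AddCommGroup M] [Module R M] [IsArtinian R M]
    (f : ι → Submodule R M) : ∃ s : Finset ι, ∀ i, s.inf f ≤ f i := by
  classical
  obtain ⟨N, ⟨s, rfl⟩, hs⟩ := (IsWellFounded.wf (r := fun a b : Submodule R M => a < b)).has_min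
    (Set.range fun s : Finset ι => s.inf f) ⟨_, ∅, rfl⟩
  refine ⟨s, fun i => ?_⟩
  by_contra h
  refine hs _ ⟨insert i s, rfl⟩ (lt_of_le_of_ne (Finset.inf_mono (Finset.subset_insert i s)) ?_)
  intro e
  exact h (e.ge.trans (Finset.inf_le (Finset.mem_insert_self i s)))

/-- The maximal two-sided ideals, among the left ideals of a ring. -/
def maximalTwoSided (R : Type*) [Ring R] : Set (Ideal R) :=
  {A | A.IsTwoSided ∧ A ≠ ⊤ ∧ ∀ B : Ideal R, B.IsTwoSided → A < B → B = ⊤}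

lemma exists_add_eq_one_of_ne {R : Type*} [Ring R] {A B : Ideal R} (hA : A ∈ maximalTwoSided R)
    (hB : B ∈ maximalTwoSided R) (h : A ≠ B) : ∃ a ∈ A, ∃ b ∈ B, a + b = 1 := by
  have := hA.1
  have := hB.1
  have h2 : (A ⊔ B).IsTwoSided := ⟨fun {x} y hx => by
    obtain ⟨a, ha, b, hb, rfl⟩ := Submodule.mem_sup.1 hx
    rw [add_mul]
    exact Submodule.add_mem_sup (Ideal.mul_mem_right y A ha) (Ideal.mul_mem_right y B hb)⟩
  have hlt : A ⊔ B = ⊤ := by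
    by_contra hne
    have h3 : A = A ⊔ B := by
      by_contra h4
      exact hne (hA.2.2 _ h2 (lt_of_le_of_ne le_sup_left h4))
    have h5 : B = A ⊔ B := by
      by_contra h4
      exact hne (hB.2.2 _ h2 (lt_of_le_of_ne le_sup_right h4))
    exact h (h3.trans h5.symm)
  exact Submodule.mem_sup.1 (hlt ▸ Submodule.mem_top)

/-- By the descending chain condition some finite intersection of maximal two-sided ideals lies in
all of them. A maximal one outside this finite family would be comaximal with the intersection, by
the Chinese remainder argument, yet contain it. -/
lemma finite_maximalTwoSided (R : Type*) [Ring R] [IsArtinianRing R] :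
    (maximalTwoSided R).Finite := by
  classical
  obtain ⟨s, hs⟩ := exists_finset_inf_le (R := R) (fun A : maximalTwoSided R => A.1)
  have key : ∀ A : maximalTwoSided R, A ∈ s := by
    intro A
    by_contra hA
    have hA2 := A.2.1
    have h : ∀ t : Finset (maximalTwoSided R), A ∉ t →
        ∃ a ∈ A.1, ∃ b ∈ t.inf (fun A : maximalTwoSided R => A.1), a + b = 1 := by
      intro t
      induction t using Finset.induction_on with
      | empty => exact fun _ => ⟨0, zero_mem _, 1, by simp, by simp⟩
      | insert B t _ ih =>
        intro hAt
        rw [Finset.mem_insert, not_or] at hAt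
        obtain ⟨a, ha, b, hb, e⟩ := ih hAt.2
        obtain ⟨c, hc, d, hd, e'⟩ := exists_add_eq_one_of_ne A.2 B.2
          (fun h => hAt.1 (Subtype.ext h))
        have hB2 := B.2.1
        have ht : (t.inf fun A : maximalTwoSided R => A.1).IsTwoSided := by
          refine ⟨fun {x} y hx => ?_⟩
          rw [Submodule.mem_finsetInf] at hx ⊢
          intro C hC
          have := C.2.1
          exact Ideal.mul_mem_right y _ (hx C hC)
        refine ⟨a + b * c, add_mem ha (Ideal.mul_mem_left _ b hc), b * d, ?_, ?_⟩
        · rw [Finset.inf_insert]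
          exact ⟨Ideal.mul_mem_left _ b hd, Ideal.mul_mem_right d _ hb⟩
        · rw [add_assoc, ← mul_add, e', mul_one, e]
    obtain ⟨a, ha, b, hb, e⟩ := h s hA
    exact A.2.2.1 ((Ideal.eq_top_iff_one _).2 (e ▸ add_mem ha (hs A hb)))
  have : Fintype (maximalTwoSided R) := ⟨s, key⟩
  exact Set.toFinite _

/-- The annihilator of a simple module over a module-finite algebra is a maximal two-sided
ideal. -/
lemma annihilator_mem_maximalTwoSided (k : Type*) {R : Type*} [CommRing k] [Ring R] [Algebra k R]
    [Module.Finite k R] (S : Type*) [AddCommGroup S] [Module R S] [IsSimpleModule R S] :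
    Module.annihilator R S ∈ maximalTwoSided R := by
  have hnt : Nontrivial S := IsSimpleModule.nontrivial R S
  refine ⟨inferInstance, fun h => ?_, fun A hA hlt => ?_⟩
  · obtain ⟨v, hv⟩ := exists_ne (0 : S)
    have h1 : (1 : R) ∈ Module.annihilator R S := h ▸ Submodule.mem_top
    exact hv ((one_smul R v).symm.trans (Module.mem_annihilator.1 h1 v))
  · obtain ⟨v, hv⟩ := exists_ne (0 : S)
    obtain ⟨n, e, he⟩ := Module.Finite.exists_fin (R := k) (M := R)
    -- R is spanned over the central ring k by the e j, so an element killing every e j • v kills R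
    -- v = S.
    have hann : ∀ a : R, (∀ j, a • e j • v = 0) → a ∈ Module.annihilator R S := by
      intro a ha
      rw [Module.mem_annihilator]
      intro w
      obtain ⟨r, rfl⟩ : ∃ r : R, r • v = w :=
        IsSimpleModule.toSpanSingleton_surjective R hv w
      have hr : r ∈ Submodule.span k (Set.range e) := he ▸ Submodule.mem_top
      obtain ⟨c, rfl⟩ := (Submodule.mem_span_range_iff_exists_fun _).1 hr
      rw [Finset.sum_smul, Finset.smul_sum]
      refine Finset.sum_eq_zero fun j _ => ?_
      rw [← mul_smul, mul_smul_comm, Algebra.smul_def, mul_smul, mul_smul, ha, smul_zero]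
    let w : Fin n → S := fun j => e j • v
    let W : Submodule R (Fin n → S) := 
      Submodule.map (LinearMap.toSpanSingleton R (Fin n → S) w) A
    -- S^n is semisimple, so w splits as a • w + c with a in A. The ideal A kills c, as A • c lies
    -- in both W and D, and A kills no nonzero element of S, so c = 0; then 1 - a kills w, hence S,
    -- and so lies in A.
    obtain ⟨D, hD⟩ := exists_isCompl W
    obtain ⟨x, hx, c, hc, hxc⟩ : ∃ x ∈ W, ∃ c ∈ D, x + c = w :=
      Submodule.mem_sup.1 (hD.sup_eq_top ▸ Submodule.mem_top)
    obtain ⟨a, ha, rfl⟩ := hx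
    have hAc : ∀ b ∈ A, b • c = 0 := by
      intro b hb
      have h1 : b • c ∈ W := by
        refine ⟨b - b * a, sub_mem hb (Ideal.mul_mem_left _ b ha), ?_⟩
        rw [← eq_sub_iff_add_eq'] at hxc
        rw [hxc, smul_sub]
        simp [sub_smul, mul_smul]
      exact (Submodule.disjoint_def.1 hD.disjoint) _ h1 (D.smul_mem b hc)
    have hc0 : c = 0 := by
      let Z : Submodule R S :=
        { carrier := {s | ∀ b ∈ A, b • s = 0}
          add_mem' := fun hs ht b hb => by rw [smul_add, hs b hb, ht b hb, add_zero]
          zero_mem' := fun b _ => smul_zero b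
          smul_mem' := fun r s hs b hb => by
            rw [← mul_smul]
            exact hs _ (Ideal.mul_mem_right r A hb) }
      have hZ : Z = ⊥ := by
        refine (eq_bot_or_eq_top Z).resolve_right fun hZ => ?_
        refine hlt.not_ge fun b hb => Module.mem_annihilator.2 fun s => ?_
        exact (hZ ▸ Submodule.mem_top : s ∈ Z) b hb
      refine funext fun j => ?_
      have : c j ∈ Z := fun b hb => congrFun (hAc b hb) j
      rw [hZ] at this
      exact this
    rw [hc0, add_zero] at hxc
    have h1 : 1 - a ∈ A := by
      refine hlt.le (hann _ fun j => ?_)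
      have := congrFun hxc j
      rw [sub_smul, one_smul, sub_eq_zero]
      exact this.symm
    rw [Ideal.eq_top_iff_one]
    simpa using add_mem h1 ha

/-- Otherwise, for each s, the elements of I killing s • x form a left ideal strictly above A, hence
all of I since I covers A. Then the annihilator of R x is two-sided and strictly larger than A, so
it is R and x = 0. The lemma embeds the simple module I/A in R x. -/
lemma exists_smul_eq_zero_iff {R : Type*} [Ring R] {A I : Ideal R} (hA : A ∈ maximalTwoSided R)
    (hI : A ⋖ I) {V : Type*} [AddCommGroup V] [Module R V] {x : V} (hx : x ≠ 0)
    (hAx : ∀ a ∈ A, a • x = 0) : ∃ s : R, ∀ i ∈ I, i • s • x = 0 ↔ i ∈ A := by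
  have hA2 := hA.1
  by_contra hcon
  push Not at hcon
  have hall : ∀ i ∈ I, ∀ s : R, i • s • x = 0 := by
    intro i hi s
    let J : Ideal R := I ⊓ LinearMap.ker (LinearMap.toSpanSingleton R V (s • x))
    have hAJ : A ≤ J := fun a ha => ⟨hI.le ha, by
      exact (mul_smul a s x).symm.trans (hAx _ (Ideal.mul_mem_right s A ha))⟩
    by_contra hne
    have hJI : J ≠ I := fun h => hne (LinearMap.mem_ker.1 (h.ge hi).2)
    have hJA : J = A := by
      by_contra h
      exact hI.2 (lt_of_le_of_ne hAJ (Ne.symm h)) (lt_of_le_of_ne inf_le_left hJI)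
    obtain ⟨i', hi', h⟩ := hcon s
    have hiff : i' • s • x = 0 ↔ i' ∈ A := by
      rw [← hJA]
      exact ⟨fun h => ⟨hi', h⟩, fun h => h.2⟩
    rcases h with h | h
    · exact h.2 (hiff.1 h.1)
    · exact h.1 (hiff.2 h.2)
  let B : Ideal R := Module.annihilator R (R ∙ x)
  have hB : ∀ b, (∀ s : R, b • s • x = 0) → b ∈ B := by
    intro b hb
    rw [Module.mem_annihilator]
    rintro ⟨y, hy⟩
    obtain ⟨s, rfl⟩ := Submodule.mem_span_singleton.1 hy
    exact Subtype.ext (hb s)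
  have hBt : B = ⊤ := hA.2.2 B inferInstance
    (lt_of_lt_of_le hI.lt fun i hi => hB i (hall i hi))
  have h1 : (1 : R) ∈ B := hBt ▸ Submodule.mem_top
  refine hx ?_
  have := Module.mem_annihilator.1 h1 ⟨x, Submodule.mem_span_singleton_self x⟩
  simpa using this

/-- Let e j generate A over k. If r ↦ (r * e j) were injective, self-injectivity would give it a
retraction h, and then 1 = h (f 1) is a sum of e j * (...), which lies in A. So some nonzero x kills
all e j, hence A. -/
lemma exists_ne_zero_mul_eq_zero (k : Type*) {R : Type u} [CommRing k] [IsNoetherianRing k]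
    [Ring R] [Algebra k R] [Module.Finite k R] (hR : Module.Injective R R) {A : Ideal R}
    [A.IsTwoSided] (hA : A ≠ ⊤) : ∃ x : R, x ≠ 0 ∧ ∀ a ∈ A, x * a = 0 := by
  have hfg : (A.restrictScalars k).FG := IsNoetherian.noetherian _
  obtain ⟨n, e, he⟩ := Submodule.fg_iff_exists_fin_generating_family.1 hfg
  have heA : ∀ j, e j ∈ A := fun j => by
    have : e j ∈ A.restrictScalars k := he ▸ Submodule.subset_span ⟨j, rfl⟩
    exact this
  let f : R →ₗ[R] (Fin n → R) := LinearMap.pi fun j => LinearMap.toSpanSingleton R R (e j)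
  by_cases hf : Function.Injective f
  · obtain ⟨h, hh⟩ := hR.out f hf LinearMap.id
    refine (hA ((Ideal.eq_top_iff_one A).2 ?_)).elim
    have h1 : h (f 1) = 1 := hh 1
    have h2 : f 1 = ∑ j, e j • Pi.single (M := fun _ : Fin n => R) j 1 := by
      rw [← Finset.univ_sum_single (f 1)]
      refine Finset.sum_congr rfl fun j _ => ?_
      rw [← Pi.single_smul']
      simp [f]
    rw [← h1, h2, map_sum]
    refine Submodule.sum_mem _ fun j _ => ?_
    rw [map_smul, smul_eq_mul]
    exact Ideal.mul_mem_right _ _ (heA j)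
  · rw [injective_iff_map_eq_zero] at hf
    push Not at hf
    obtain ⟨x, hx, hx0⟩ := hf
    refine ⟨x, hx0, fun a ha => ?_⟩
    have ha' : a ∈ Submodule.span k (Set.range e) := he ▸ ha
    obtain ⟨c, rfl⟩ := (Submodule.mem_span_range_iff_exists_fun _).1 ha'
    rw [Finset.mul_sum]
    refine Finset.sum_eq_zero fun j _ => ?_
    have : x * e j = 0 := congrFun hx j
    rw [mul_smul_comm, this, smul_zero]

section SelfInjective

variable (k : Type*) {R : Type u} [CommRing k] [IsArtinianRing k] [Ring R] [Algebra k R]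
  [Module.Finite k R] (hR : Module.Injective R R)
include k hR

/-- In a self-injective algebra, every maximal two-sided ideal kills a nonzero element. -/
lemma exists_ne_zero_maximalTwoSided_mul_eq_zero {A : Ideal R} (hA : A ∈ maximalTwoSided R) :
    ∃ x : R, x ≠ 0 ∧ ∀ a ∈ A, a * x = 0 := by
  have hart : IsArtinianRing R := isArtinian_of_tower k (inferInstance : IsArtinian k R)
  -- To B attach C, the annihilator of a simple submodule of the nonzero left ideal {x | x B = 0},
  -- in the manner of the Nakayama permutation.
  have hrel : ∀ B : maximalTwoSided R, ∃ C : maximalTwoSided R, ∃ x : R, x ≠ 0 ∧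
      (∀ b ∈ B.1, x * b = 0) ∧ ∀ c ∈ C.1, c * x = 0 := by
    rintro ⟨B, hB⟩
    have := hB.1
    obtain ⟨y, hy0, hy⟩ := exists_ne_zero_mul_eq_zero k hR hB.2.1
    let N : Ideal R :=
      { carrier := {x | ∀ b ∈ B, x * b = 0}
        add_mem' := fun hs ht b hb => by rw [add_mul, hs b hb, ht b hb, add_zero]
        zero_mem' := fun b _ => zero_mul b
        smul_mem' := fun r s hs b hb => by rw [smul_eq_mul, mul_assoc, hs b hb, mul_zero] }
    obtain hN | ⟨S, hS, hSN⟩ := eq_bot_or_exists_atom_le N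
    · exact (hy0 (by simpa [hN] using (show y ∈ N from hy))).elim
    · have : IsSimpleModule R S := isSimpleModule_iff_isAtom.2 hS
      obtain ⟨x, hxS, hx0⟩ := S.ne_bot_iff.1 hS.1
      refine ⟨⟨_, annihilator_mem_maximalTwoSided k S⟩, x, hx0, hSN hxS, fun c hc => ?_⟩
      exact congrArg Subtype.val (Module.mem_annihilator.1 hc ⟨x, hxS⟩)
  choose f x hx0 hxB hxC using hrel
  have hinj : Function.Injective f := by
    intro B B' hBB'
    by_contra hne
    obtain ⟨I, hI, -⟩ := exists_covBy_le_of_lt (lt_top_iff_ne_top.2 (f B).2.2.1)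
    obtain ⟨s, hs⟩ := exists_smul_eq_zero_iff (f B).2 hI (hx0 B) (hxC B)
    obtain ⟨t, ht⟩ := exists_smul_eq_zero_iff (f B).2 hI (hx0 B') (hBB' ▸ hxC B')
    let p : I →ₗ[R] R := LinearMap.toSpanSingleton R R (s • x B) ∘ₗ I.subtype
    let q : I →ₗ[R] R := LinearMap.toSpanSingleton R R (t • x B') ∘ₗ I.subtype
    obtain ⟨g, hg⟩ := exists_linear_desc (LinearMap.surjective_rangeRestrict p) q fun i hi =>
      (ht i i.2).2 ((hs i i.2).1 (congrArg Subtype.val hi))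
    obtain ⟨h, hh⟩ := hR.out (LinearMap.range p).subtype Subtype.val_injective g
    -- If B and B' share the same C, then I/C embeds in R via both x B and x B'. Injectivity of R
    -- makes the embeddings differ by right multiplication by h 1, so q is killed on the right by
    -- both B and B', which are comaximal.
    have hpq : ∀ i : I, q i = p i * h 1 := fun i => by
      have e1 : q i = h (p i) := (LinearMap.congr_fun hg i).symm.trans (hh _).symm
      rw [e1, ← smul_eq_mul, ← map_smul, smul_eq_mul, mul_one]
    obtain ⟨i, hi, hiA⟩ := Set.exists_of_ssubset hI.lt
    obtain ⟨b, hb, b', hb', e⟩ := exists_add_eq_one_of_ne B.2 B'.2 fun h => hne (Subtype.ext h)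
    have hB2 := B.2.1
    have hqi : q ⟨i, hi⟩ ≠ 0 := fun h => hiA ((ht i hi).1 h)
    refine hqi ?_
    rw [← mul_one (q ⟨i, hi⟩), ← e, mul_add]
    have e1 : q ⟨i, hi⟩ * b = 0 := by
      rw [hpq]
      change i * (s * x B) * h 1 * b = 0
      rw [mul_assoc, mul_assoc, mul_assoc, hxB B _ (Ideal.mul_mem_left _ (h 1) hb), mul_zero,
        mul_zero]
    have e2 : q ⟨i, hi⟩ * b' = 0 := by
      change i * (t * x B') * b' = 0
      rw [mul_assoc, mul_assoc, hxB B' b' hb', mul_zero, mul_zero]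
    rw [e1, e2, add_zero]
  have : Finite (maximalTwoSided R) := finite_maximalTwoSided R
  -- An injective self-map of a finite set is onto, so A is attached to some B.
  obtain ⟨B, hB⟩ := Finite.surjective_of_injective hinj ⟨A, hA⟩
  refine ⟨x B, hx0 B, fun a ha => hxC B a ?_⟩
  rw [hB]
  exact ha

/-- Every simple module over a self-injective algebra embeds into the algebra. -/
lemma exists_injective_of_isSimpleModule (S : Type*) [AddCommGroup S] [Module R S]
    [IsSimpleModule R S] : ∃ f : S →ₗ[R] R, Function.Injective f := by
  have hart : IsArtinianRing R := isArtinian_of_tower k (inferInstance : IsArtinian k R)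
  have hnt : Nontrivial S := IsSimpleModule.nontrivial R S
  obtain ⟨v, hv⟩ := exists_ne (0 : S)
  have hA := annihilator_mem_maximalTwoSided k (R := R) S
  obtain ⟨x, hx0, hx⟩ := exists_ne_zero_maximalTwoSided_mul_eq_zero k hR hA
  obtain ⟨I, hI, -⟩ := exists_covBy_le_of_lt (lt_top_iff_ne_top.2 hA.2.1)
  -- For I covering A = Ann(S), the simple module I/A maps onto S and embeds in R; comparing the two
  -- maps embeds S in R.
  obtain ⟨s, hs⟩ := exists_smul_eq_zero_iff hA hI hv fun a ha => Module.mem_annihilator.1 ha v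
  obtain ⟨t, ht⟩ := exists_smul_eq_zero_iff hA hI hx0 hx
  let p : I →ₗ[R] S := LinearMap.toSpanSingleton R S (s • v) ∘ₗ I.subtype
  let q : I →ₗ[R] R := LinearMap.toSpanSingleton R R (t • x) ∘ₗ I.subtype
  obtain ⟨i, hi, hiA⟩ := Set.exists_of_ssubset hI.lt
  have hp : Function.Surjective p := LinearMap.surjective_of_ne_zero fun h =>
    hiA ((hs i hi).1 (LinearMap.congr_fun h ⟨i, hi⟩))
  obtain ⟨g, hg⟩ := exists_linear_desc hp q fun i hi => (ht i i.2).2 ((hs i i.2).1 hi)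
  refine ⟨g, LinearMap.injective_of_ne_zero fun h => hiA ((ht i hi).1 ?_)⟩
  exact (LinearMap.congr_fun hg ⟨i, hi⟩).symm.trans (by rw [h]; rfl)

end SelfInjective

/-- Over a self-injective artin algebra every finitely generated module is a submodule of a free
module. -/
theorem exists_injective_to_free {Λ : Type u} [Ring Λ] [IsArtinAlgebra Λ]
    (hΛ : IsSelfInjective Λ) (M : RMod Λ) :
    ∃ (n : ℕ) (i : M ⟶ free Λ n), Function.Injective i.hom.hom := by
  obtain ⟨k, _, _, _, _⟩ := IsArtinAlgebra.exists_base (Λ := Λ)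
  have : Module.Finite k Λᵐᵒᵖ := Module.Finite.equiv (MulOpposite.opLinearEquiv k)
  let e : Λᵐᵒᵖ ≃ₗ[Λᵐᵒᵖ] Λ :=
    { toFun := MulOpposite.unop
      map_add' := fun _ _ => rfl
      map_smul' := fun _ _ => rfl
      invFun := MulOpposite.op
      left_inv := fun _ => rfl
      right_inv := fun _ => rfl }
  have hinj : Module.Injective Λᵐᵒᵖ Λ := hΛ
  have hR : Module.Injective Λᵐᵒᵖ Λᵐᵒᵖ :=
    Module.Baer.injective (Module.Baer.of_equiv e.symm (Module.Baer.of_injective hinj))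
  obtain ⟨s, hs⟩ := exists_finset_inf_le (R := Λᵐᵒᵖ) fun φ : M →ₗ[Λᵐᵒᵖ] Λ => LinearMap.ker φ
  -- A simple submodule of the common kernel would embed in Λ, and that embedding would extend to a
  -- functional on M, which the common kernel must kill.
  have hbot : s.inf (fun φ : M →ₗ[Λᵐᵒᵖ] Λ => LinearMap.ker φ) = ⊥ := by
    refine (eq_bot_or_exists_atom_le _).resolve_right ?_
    rintro ⟨S, hS, hle⟩
    have : IsSimpleModule Λᵐᵒᵖ S := isSimpleModule_iff_isAtom.2 hS
    obtain ⟨f, hf⟩ := exists_injective_of_isSimpleModule k hR S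
    obtain ⟨h, hh⟩ := hinj.out S.subtype Subtype.val_injective (e.toLinearMap ∘ₗ f)
    obtain ⟨x, hxS, hx0⟩ := S.ne_bot_iff.1 hS.1
    have hx : h x = 0 := hs h (hle hxS)
    have h1 : e (f ⟨x, hxS⟩) = 0 := (hh ⟨x, hxS⟩).symm.trans hx
    have h2 : (⟨x, hxS⟩ : S) = 0 := hf ((e.map_eq_zero_iff.1 h1).trans (map_zero f).symm)
    exact hx0 (congrArg Subtype.val h2)
  let E := s.equivFin.symm
  refine ⟨s.card, ObjectProperty.homMk (ModuleCat.ofHom (LinearMap.pi fun j => (E j).1)),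
    (injective_iff_map_eq_zero (LinearMap.pi fun j => (E j).1)).2 fun x hx => ?_⟩
  have hx' : x ∈ s.inf (fun φ : M →ₗ[Λᵐᵒᵖ] Λ => LinearMap.ker φ) := by
    rw [Submodule.mem_finsetInf]
    intro φ hφ
    have h1 : (E (E.symm ⟨φ, hφ⟩)).1 x = 0 := congrFun hx (E.symm ⟨φ, hφ⟩)
    rwa [E.apply_symm_apply] at h1
  rw [hbot] at hx'
  exact hx'

end Cogenerator

end RelAus

end

theorem mainTheorem4 {Λ : Type u} [Ring Λ] [RelAus.IsArtinAlgebra Λ]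
    (𝒳 : ObjectProperty (RelAus.RMod Λ))
    (hcf : RelAus.ContravariantlyFinite 𝒳)
    (hprj : RelAus.prj Λ ≤ 𝒳)
    (hsub : 𝒳.IsClosedUnderSubobjects)
    (hperp : 𝒳 ≤ RelAus.leftPerp Λ)
    (X : 𝒳.FullSubcategory)
    (hX : RelAus.IsAddGenerator 𝒳 X) :
    -- the recollements `R(𝒳, Λ)` and `R(𝒳, Γ)` exist
    Nonempty (RelAus.RecollementX (hprj _ (RelAus.prj_regular Λ))) ∧
    Nonempty (RelAus.RecollementΓ hX) ∧
    ∀ (R : RelAus.RecollementX (hprj _ (RelAus.prj_regular Λ))) (S : RelAus.RecollementΓ hX),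
      (RelAus.cogen (RelAus.zetaXX hX R) ≤ S.ℓrho.kernel ∧
        S.ℓrho.kernel = RelAus.projDimLEOne (RelAus.Aus X.obj) ∧
        (RelAus.IsSelfInjective Λ → RelAus.cogen (RelAus.zetaXX hX R) = S.ℓrho.kernel)) ∧
      (S.ℓlam.kernel = RelAus.gen (RelAus.zetaXX hX R) ∧
        RelAus.gen (RelAus.zetaXX hX R) ≤ RelAus.injDimLEOne (RelAus.Aus X.obj) ∧
        (RelAus.IsSelfInjective Λ →
          RelAus.gen (RelAus.zetaXX hX R) = RelAus.injDimLEOne (RelAus.Aus X.obj))) := by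
  have hΛ : 𝒳 (RelAus.regular Λ) := hprj _ (RelAus.prj_regular Λ)
  refine ⟨RelAus.nonempty_recollementX hcf hprj hsub hX,
    RelAus.nonempty_recollementΓ hcf hprj hsub hX, fun R S => ?_⟩
  obtain ⟨j, hj, hjr⟩ := RelAus.exists_zetaXX_embedding hcf hsub hX R
  have hcogen := RelAus.cogen_le_ℓrho_kernel hprj hsub hX S hj
  have hgen : ∀ N, RelAus.gen (RelAus.zetaXX hX R) N ↔ RelAus.regularTrace X N = ⊤ :=
    RelAus.gen_iff_regularTrace_eq_top hX hΛ hj hjr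
  have hgen_le : RelAus.gen (RelAus.zetaXX hX R) ≤ RelAus.injDimLEOne (RelAus.Aus X.obj) :=
    fun N hN => RelAus.hasInjectiveDimensionLE_one_of_regularTrace_eq_top hsub hperp hX
      ((hgen N).1 hN)
  refine ⟨⟨hcogen, RelAus.ℓrho_kernel_eq_projDimLEOne hprj hsub hX S, fun hself => ?_⟩, ?_,
    hgen_le, fun hself => ?_⟩
  · exact le_antisymm hcogen (RelAus.ℓrho_kernel_le_cogen hprj hsub hX S
      (RelAus.exists_injective_to_free hself) hj hjr)
  · ext N
    exact (RelAus.ℓlam_kernel_iff_regularTrace_eq_top hX hΛ S N).trans (hgen N).symm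
  · exact le_antisymm hgen_le fun N hN => (hgen N).2
      (RelAus.regularTrace_eq_top_of_hasInjectiveDimensionLE_one hprj hsub hX
        (RelAus.exists_injective_to_free hself) hN)
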